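/- Let $G=(V,E)$ be a finite simple undirected graph and let $X=(X_e)_{e\in E}$ be real edge weights. A configuration is a map $\gamma:V\to\{-1,1\}$, and its weight is the weight of the corresponding cut, $$\mathrm{obj}_{G,X}(\gamma)=\sum_{\{u,v\}\in E} X_{\{u,v\}}\,\mathbf 1\{\gamma(u)\neq\gamma(v)\}.$$ For $v\in V$ let $\gamma^{(v)}$ be the configuration obtained from $\gamma$ by changing the sign of $\gamma(v)$. The configuration $\gamma$ is a local optimum if $\mathrm{obj}_{G,X}(\gamma^{(v)})\le \mathrm{obj}_{G,X}(\gamma)$ for all $v\in V$. The FLIP algorithm starts from an arbitrary configuration and, as long as the current configuration $\gamma$ is not a local optimum, replaces it by $\gamma^{(v)}$ for some node $v$ with $\mathrm{obj}_{G,X}(\gamma^{(v)})>\mathrm{obj}_{G,X}(\gamma)$. The node is selected by a pivoting rule, which may depend on $G$, on $X$ and on the whole history of the execution. The configuration graph of $(G,X)$ is the directed graph on all configurations that has an edge from $\gamma$ to $\gamma'$ if $\gamma'=\gamma^{(v)}$ for some $v\in V$ and $\mathrm{obj}_{G,X}(\gamma')>\mathrm{obj}_{G,X}(\gamma)$. **Theorem.**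 There are an absolute constant $C>0$ and a function $\delta:\mathbb N\to\mathbb R$ with $\delta(n)\to 0$ as $n\to\infty$ such that the following holds for every $n$, every $\phi>0$, every undirected graph $G=(V,E)$ on $n$ vertices, and every family $(\mathcal X_e)_{e\in E}$ of probability distributions such that each $\mathcal X_e$ is supported on $[-1,1]$ and has a density bounded from above by $\phi$. If the weights $X_e\sim\mathcal X_e$ are drawn independently, then with probability at least $1-\delta(n)$ both of the following hold: 1. for every pivoting rule and every initial configuration, the FLIP algorithm on $G$ and $X$ terminates after at most $\phi\, n^{C\sqrt{\log n}}$ flips; 2. every directed path in the configuration graph of $(G,X)$ has length at most $\phi\, n^{C\sqrt{\log n}}$. -/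

import Mathlib

open MeasureTheory Filter Topology

universe u

namespace LocalMaxCut

noncomputable section

/-- The probability measure `μ` on `ℝ` is supported on `[-1, 1]` and has a density (with respect to
Lebesgue measure) that is bounded from above by `φ`. -/
structure IsSmoothedLaw (μ : Measure ℝ) (φ : ℝ) : Prop where
  isProbabilityMeasure : IsProbabilityMeasure μ
  supported : μ (Set.Icc (-1) 1)ᶜ = 0
  bounded_density : ∃ f : ℝ → ℝ, Measurable f ∧ (∀ x, 0 ≤ f x) ∧ (∀ x, f x ≤ φ) ∧
    μ = volume.withDensity (fun x => ENNReal.ofReal (f x))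

/-- A configuration of `V`: a map `V → {-1, 1}`, i.e. a partition of `V` in two parts. -/
abbrev Config (V : Type u) : Type u := V → ℤˣ

section

variable {V : Type u}

open scoped Classical in
/-- The configuration obtained from `γ` by flipping the sign of `γ v`. -/
def flip (γ : Config V) (v : V) : Config V := Function.update γ v (-γ v)

variable [Fintype V] (G : SimpleGraph V) (X : G.edgeSet → ℝ)

open scoped Classical in
/-- The law of the edge weights: independent draws, the weight of `e` being drawn from `𝒳 e`. -/
def weightLaw (𝒳 : G.edgeSet → Measure ℝ) : Measure (G.edgeSet → ℝ) := Measure.pi 𝒳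

open scoped Classical in
/-- The cut weight of `γ`: the sum of the weights of all edges whose endpoints lie in different
parts. -/
def cutWeight (γ : Config V) : ℝ :=
  ∑ e : G.edgeSet, if ∃ u ∈ e.1, ∃ v ∈ e.1, γ u ≠ γ v then X e else 0

/-- Flipping `v` strictly increases the weight of the cut. -/
def IsImproving (γ : Config V) (v : V) : Prop :=
  cutWeight G X γ < cutWeight G X (flip γ v)

/-- No single flip increases the weight of the cut. -/
def IsLocalOpt (γ : Config V) : Prop :=
  ∀ v, cutWeight G X (flip γ v) ≤ cutWeight G X γ

/-- The improving configuration graph: there is an edge from `γ` to `γ'` if `γ'` is obtained from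
`γ` by flipping one node and has strictly larger cut weight. -/
def configGraph : Digraph (Config V) where
  Adj γ γ' := ∃ v, γ' = flip γ v ∧ cutWeight G X γ < cutWeight G X γ'

/-- A pivoting rule: from the list of all earlier configurations (latest first) and the current
configuration, if the latter is not locally optimal, it selects a node whose flip is improving. -/
structure PivotRule where
  select : List (Config V) → (γ : Config V) → ¬ IsLocalOpt G X γ → V
  improving : ∀ past γ h, IsImproving G X γ (select past γ h)

variable {G X}

open scoped Classical in
/-- The state (earlier configurations, current configuration) of FLIP with pivoting rule `R` and
initial configuration `γ₀` after `k` rounds. The algorithm halts (its state stays unchanged) as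
soon as the current configuration is locally optimal. -/
def PivotRule.run (R : PivotRule G X) (γ₀ : Config V) : ℕ → List (Config V) × Config V
  | 0 => ([], γ₀)
  | k + 1 =>
    if h : IsLocalOpt G X (R.run γ₀ k).2 then R.run γ₀ k
    else ((R.run γ₀ k).2 :: (R.run γ₀ k).1,
      flip (R.run γ₀ k).2 (R.select (R.run γ₀ k).1 (R.run γ₀ k).2 h))

/-- FLIP with pivoting rule `R` and initial configuration `γ₀` terminates after at most `T`
flips. -/
def PivotRule.TerminatesWithin (R : PivotRule G X) (γ₀ : Config V) (T : ℝ) : Prop :=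
  ∃ k : ℕ, (k : ℝ) ≤ T ∧ IsLocalOpt G X (R.run γ₀ k).2

end

end

end LocalMaxCut

/-! Flipping `v` changes the cut weight by the sum of `γ v * γ u * X` over the edges `vu`. For an
arc, that is two consecutive moves of `v` at times `i < j`, the two gains add up to a linear form in
`X` that lives on the edges to those neighbours whose sign differs at `i` and `j`, with coefficients
`±2`. No other signs matter. If an improving path of `N = 2 n` flips gains at most `ε`, all these
forms lie in `(0, ε]`.

Suppose that the forms of a set `A` of arcs are diagonal: each has an edge absent from all the
others. By independence and the density bound they are all at most `ε` in absolute value with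
probability at most `(2 ε φ) ^ |A|` (`pi_forall_abs_sum_le`). If they are determined by `K |A|`
claims "this node keeps this sign during this interval", out of `M = poly(n)` possible claims, a
union bound over arcs and claims gives failure probability `O(M (M + 1) ^ K ε φ)`. With `K = O(√(log
n))` one may take `1 / ε = φ n ^ O(√(log n))`. Every block of `2 n` flips then gains more than `ε`,
while the total gain is at most `2 n ^ 2`.

The core is `hasCertificate`, which gives `K = O(m)` when `2 n ≤ 2 ^ m ^ 2`. A window of moves is
itself a certificate if its repeated nodes, or its light arcs, make up a proportion of order `1 / m`
of its length; so assume that both are rarer in every window. Averaging over windows of all dyadic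
lengths, `N / 4` arcs are good: the gaps to the adjacent moves of the same node are not shorter by a
factor `2 ^ (m + 1)`, and every changed neighbour moves at least twice in a window larger by about
that factor. For good arcs of length about `2 ^ k`, the moves to be recorded are ends of arcs whose
length is within a factor `2 ^ O(m)` of `2 ^ k`, or ends of short arcs of rare types. An arc is of
the former kind at only `O(m)` of the `m ^ 2` scales, so at some scale there are `O(m)` recorded
moves per good arc. There, the good arcs crossing a suitable moment form the certificate. -/

namespace LocalMaxCut

/-! ### Move sequences, arcs and certificates -/

section Trajectory

variable {V : Type u}

/-- `i < j < N` are consecutive moves of the same node in the move sequence `s`. -/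
def IsArc (N : ℕ) (s : ℕ → V) (i j : ℕ) : Prop :=
  i < j ∧ j < N ∧ s i = s j ∧ ∀ k, i < k → k < j → s k ≠ s i

/-- The configurations `γ 0, …, γ N` are obtained by performing the moves `s 0, …, s (N - 1)`. -/
def IsTrajectory (N : ℕ) (s : ℕ → V) (γ : ℕ → Config V) : Prop :=
  ∀ t < N, γ (t + 1) = flip (γ t) (s t)

theorem flip_apply_self (γ : Config V) (v : V) : flip γ v v = -γ v := by
  simp [flip]

theorem flip_apply_of_ne (γ : Config V) {v u : V} (h : u ≠ v) : flip γ v u = γ u := by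
  simp [flip, h]

theorem IsTrajectory.eq_of_forall_ne {N : ℕ} {s : ℕ → V} {γ : ℕ → Config V}
    (hγ : IsTrajectory N s γ) {x y : ℕ} (hxy : x ≤ y) (hy : y ≤ N) {u : V}
    (h : ∀ t, x ≤ t → t < y → s t ≠ u) : γ y u = γ x u := by
  induction y, hxy using Nat.le_induction with
  | base => rfl
  | succ y hxy ih =>
    rw [hγ y (by omega), flip_apply_of_ne _ (h y hxy (by omega)).symm]
    exact ih (by omega) fun t h1 h2 => h t h1 (by omega)

theorem IsTrajectory.exists_of_ne {N : ℕ} {s : ℕ → V} {γ : ℕ → Config V}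
    (hγ : IsTrajectory N s γ) {x y : ℕ} (hxy : x ≤ y) (hy : y ≤ N) {u : V}
    (h : γ x u ≠ γ y u) : ∃ t, x ≤ t ∧ t < y ∧ s t = u := by
  by_contra! hc
  exact h (hγ.eq_of_forall_ne hxy hy hc).symm

theorem IsTrajectory.eq_neg_of_unique {N : ℕ} {s : ℕ → V} {γ : ℕ → Config V}
    (hγ : IsTrajectory N s γ) {x t y : ℕ} (hxt : x ≤ t) (hty : t < y) (hy : y ≤ N) {u : V}
    (ht : s t = u) (h : ∀ k, x ≤ k → k < y → s k = u → k = t) : γ y u = -γ x u := by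
  have h1 : γ t u = γ x u := hγ.eq_of_forall_ne hxt (by omega) fun k hk hk' he => by
    have := h k hk (by omega) he
    omega
  have h2 : γ y u = γ (t + 1) u := hγ.eq_of_forall_ne hty hy fun k hk hk' he => by
    have := h k (by omega) (by omega) he
    omega
  rw [h2, hγ t (by omega), ← ht, flip_apply_self, ht, h1]

theorem IsTrajectory.ne_of_unique {N : ℕ} {s : ℕ → V} {γ : ℕ → Config V}
    (hγ : IsTrajectory N s γ) {x t y : ℕ} (hxt : x ≤ t) (hty : t < y) (hy : y ≤ N) {u : V}
    (ht : s t = u) (h : ∀ k, x ≤ k → k < y → s k = u → k = t) : γ x u ≠ γ y u := by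
  rw [hγ.eq_neg_of_unique hxt hty hy ht h]
  rcases Int.units_eq_one_or (γ x u) with h | h <;> rw [h] <;> decide

theorem IsArc.eq_neg {N : ℕ} {s : ℕ → V} {γ : ℕ → Config V} {i j : ℕ} (ha : IsArc N s i j)
    (hγ : IsTrajectory N s γ) : γ j (s i) = -γ i (s i) := by
  obtain ⟨h1, h2, h3, h4⟩ := ha
  refine hγ.eq_neg_of_unique le_rfl h1 h2.le rfl fun k hk hkj he => ?_
  by_contra hne
  exact h4 k (by omega) hkj he

/-- Two arcs of the same node have disjoint interiors. -/
theorem IsArc.le_or_le {N : ℕ} {s : ℕ → V} {i j i' j' : ℕ} (h : IsArc N s i j)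
    (h' : IsArc N s i' j') (hs : s i' = s i) (hne : i ≠ i') : j ≤ i' ∨ j' ≤ i := by
  obtain ⟨h1, h2, h3, h4⟩ := h
  obtain ⟨h1', h2', h3', h4'⟩ := h'
  rcases lt_or_gt_of_ne hne with hlt | hlt
  · left
    by_contra hc
    exact h4 i' hlt (by omega) hs
  · right
    by_contra hc
    exact h4' i hlt (by omega) hs.symm

theorem IsArc.right_unique {N : ℕ} {s : ℕ → V} {i j j' : ℕ} (h : IsArc N s i j)
    (h' : IsArc N s i j') : j = j' := by
  obtain ⟨h1, h2, h3, h4⟩ := h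
  obtain ⟨h1', h2', h3', h4'⟩ := h'
  rcases lt_trichotomy j j' with hl | hl | hl
  · exact absurd h3.symm (h4' j h1 hl)
  · exact hl
  · exact absurd h3'.symm (h4 j' h1' hl)

theorem IsArc.left_unique {N : ℕ} {s : ℕ → V} {i i' j : ℕ} (h : IsArc N s i j)
    (h' : IsArc N s i' j) : i = i' := by
  by_contra hne
  have := h.le_or_le h' (h'.2.2.1.trans h.2.2.1.symm) hne
  have := h.1
  have := h'.1
  omega

/-- The last time before `j` at which `P` holds. -/
theorem exists_last_lt {P : ℕ → Prop} {j : ℕ} (h : ∃ p < j, P p) :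
    ∃ p < j, P p ∧ ∀ k, p < k → k < j → ¬ P k := by
  classical
  obtain ⟨p, hp, hP⟩ := h
  have h1 := Nat.findGreatest_spec (P := P) (n := j - 1) (by omega) hP
  have h2 := Nat.findGreatest_le (P := P) (j - 1)
  refine ⟨Nat.findGreatest P (j - 1), by omega, h1, fun k hk hk' => ?_⟩
  exact Nat.findGreatest_is_greatest hk (by omega)

/-- The first time from `i` on at which `P` holds. -/
theorem exists_first_ge {P : ℕ → Prop} {i x : ℕ} (hx : i ≤ x) (hP : P x) :
    ∃ q, i ≤ q ∧ q ≤ x ∧ P q ∧ ∀ k, i ≤ k → k < q → ¬ P k := by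
  classical
  have h : ∃ q, i ≤ q ∧ P q := ⟨x, hx, hP⟩
  refine ⟨Nat.find h, (Nat.find_spec h).1, Nat.find_min' h ⟨hx, hP⟩, (Nat.find_spec h).2, ?_⟩
  intro k hk hk' hPk
  exact Nat.find_min h hk' ⟨hk, hPk⟩

theorem exists_isArc_left {N : ℕ} {s : ℕ → V} {j p : ℕ} (hj : j < N) (hp : p < j)
    (hs : s p = s j) : ∃ i, p ≤ i ∧ IsArc N s i j := by
  obtain ⟨i, hi, hsi, hmax⟩ := exists_last_lt (P := fun k => s k = s j) ⟨p, hp, hs⟩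
  refine ⟨i, ?_, hi, hj, hsi, fun k hk hk' => ?_⟩
  · by_contra hc
    exact hmax p (by omega) hp hs
  · rw [hsi]
    exact hmax k hk hk'

theorem exists_isArc_right {N : ℕ} {s : ℕ → V} {i q : ℕ} (hq : q < N) (hi : i < q)
    (hs : s q = s i) : ∃ j, j ≤ q ∧ IsArc N s i j := by
  obtain ⟨j, hj, hjq, hsj, hmin⟩ := exists_first_ge (P := fun k => s k = s i) (i := i + 1) hi hs
  exact ⟨j, hjq, hj, by omega, hsj.symm, fun k hk hk' => hmin k hk hk'⟩

open scoped Classical in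
/-- The set of arcs of a move sequence of length `N`. -/
noncomputable def arcs (N : ℕ) (s : ℕ → V) : Finset (ℕ × ℕ) :=
  (Finset.range N ×ˢ Finset.range N).filter fun a => IsArc N s a.1 a.2

theorem mem_arcs {N : ℕ} {s : ℕ → V} {a : ℕ × ℕ} : a ∈ arcs N s ↔ IsArc N s a.1 a.2 := by
  simp only [arcs, Finset.mem_filter, Finset.mem_product, Finset.mem_range, and_iff_right_iff_imp]
  intro h
  exact ⟨h.1.trans h.2.1, h.2.1⟩

/-- Every move is the right end of an arc, except for the first move of each node. -/
theorem le_card_arcs_add_card [Fintype V] (N : ℕ) (s : ℕ → V) :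
    N ≤ (arcs N s).card + Fintype.card V := by
  classical
  have h := Finset.card_filter_add_card_filter_not (s := Finset.range N)
    (fun j => ∃ p < j, s p = s j)
  rw [Finset.card_range] at h
  have h1 : ((Finset.range N).filter fun j => ∃ p < j, s p = s j).card ≤ (arcs N s).card := by
    refine (Finset.card_le_card ?_).trans (Finset.card_image_le (f := Prod.snd))
    intro j hj
    simp only [Finset.mem_filter, Finset.mem_range] at hj
    obtain ⟨hj, p, hp, hs⟩ := hj
    obtain ⟨i, -, hi⟩ := exists_isArc_left hj hp hs
    exact Finset.mem_image.2 ⟨(i, j), mem_arcs.2 hi, rfl⟩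
  have h2 : ((Finset.range N).filter fun j => ¬ ∃ p < j, s p = s j).card ≤ Fintype.card V := by
    refine Finset.card_le_card_of_injOn s (fun _ _ => Finset.mem_univ _) ?_
    intro x hx y hy hxy
    simp only [Finset.coe_filter, Finset.mem_range, Set.mem_ofPred_eq] at hx hy
    rcases lt_trichotomy x y with hl | hl | hl
    · exact absurd ⟨x, hl, hxy⟩ hy.2
    · exact hl
    · exact absurd ⟨y, hl, hxy.symm⟩ hx.2
  omega

/-- Some bipartition separates, in the right direction, a quarter of any family of pairs. -/
theorem exists_set_separating {ι : Type*} [Fintype V] (A : Finset ι) (f g : ι → V)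
    (h : ∀ a ∈ A, f a ≠ g a) :
    ∃ S : Set V, ∃ B ⊆ A, A.card ≤ 4 * B.card ∧ ∀ a ∈ B, f a ∈ S ∧ g a ∉ S := by
  classical
  have key : ∀ a ∈ A, Fintype.card (V → Bool) ≤
      4 * (Finset.univ.filter fun S : V → Bool => S (f a) = true ∧ S (g a) = false).card := by
    intro a ha
    have hne := h a ha
    -- Overwriting the values at `f a` and `g a` while remembering the old ones is injective, so a
    -- quarter of all bipartitions separate this pair. Averaging over bipartitions then gives a
    -- single one.
    have : Fintype.card (V → Bool) ≤
        ((Finset.univ.filter fun S : V → Bool => S (f a) = true ∧ S (g a) = false) ×ˢ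
          (Finset.univ : Finset (Bool × Bool))).card := by
      rw [← Finset.card_univ]
      refine Finset.card_le_card_of_injOn (fun S =>
        (Function.update (Function.update S (f a) true) (g a) false, (S (f a), S (g a)))) ?_ ?_
      · intro S _
        simp [Function.update_of_ne hne]
      · intro S _ S' _ he
        simp only [Prod.mk.injEq] at he
        obtain ⟨h1, h2, h3⟩ := he
        funext v
        by_cases hg : v = g a
        · rw [hg, h3]
        by_cases hf : v = f a
        · rw [hf, h2]
        · simpa [hg, hf] using congrFun h1 v
    rw [Finset.card_product] at this
    simp only [Finset.card_univ, Fintype.card_prod, Fintype.card_bool] at this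
    omega
  obtain ⟨S, -, hS⟩ : ∃ S ∈ (Finset.univ : Finset (V → Bool)), A.card ≤
      4 * (A.filter fun a => S (f a) = true ∧ S (g a) = false).card := by
    refine Finset.exists_le_of_sum_le Finset.univ_nonempty ?_
    rw [Finset.sum_const, ← Finset.mul_sum]
    have hswap := Finset.sum_card_bipartiteAbove_eq_sum_card_bipartiteBelow
      (s := (Finset.univ : Finset (V → Bool))) (t := A)
      (fun S a => S (f a) = true ∧ S (g a) = false)
    simp only [Finset.bipartiteAbove, Finset.bipartiteBelow] at hswap
    rw [hswap, Finset.mul_sum, Finset.card_univ, smul_eq_mul, mul_comm, ← smul_eq_mul,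
      ← Finset.sum_const]
    exact Finset.sum_le_sum key
  refine ⟨{v | S v = true}, _, Finset.filter_subset _ _, hS, fun a ha => ?_⟩
  simpa using (Finset.mem_filter.1 ha).2

/-- A set `A` of arcs with a diagonal system of witnesses, together with sets `L` and `R` of moves
such that, at both ends of every arc in `A`, the state of every neighbour that has changed along
the arc can be read off from a move in `L` (looking forward) or in `R` (looking backward). The
number of these moves is at most `K` times the number of arcs. -/
def HasCertificate (G : SimpleGraph V) (N : ℕ) (s : ℕ → V) (γ : ℕ → Config V) (K : ℕ) : Prop :=
  ∃ (A : Finset (ℕ × ℕ)) (w : ℕ × ℕ → V) (L R : Finset ℕ),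
    A.Nonempty ∧ (∀ q ∈ L, q < N) ∧ (∀ p ∈ R, p < N) ∧ L.card + R.card ≤ K * A.card ∧
    (∀ a ∈ A, IsArc N s a.1 a.2 ∧ G.Adj (s a.1) (w a) ∧ γ a.1 (w a) ≠ γ a.2 (w a)) ∧
    (∀ a ∈ A, ∀ b ∈ A, a ≠ b →
      s b.1 ≠ w a ∧ (s b.1 = s a.1 → γ b.1 (w a) = γ b.2 (w a))) ∧
    ∀ a ∈ A, ∀ u, G.Adj (s a.1) u → γ a.1 u ≠ γ a.2 u →
      (∃ q ∈ L, s q = u ∧ a.1 ≤ q ∧ ∀ z, a.1 ≤ z → z < q → s z ≠ u) ∧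
      ∃ p ∈ R, s p = u ∧ p < a.2 ∧ ∀ z, p < z → z < a.2 → s z ≠ u

/-- Once all nodes of arcs lie in a set `S` and all witnesses outside it, only arcs of the same node
can clash. A suitable `S` keeps a quarter of the arcs, whence the factor 4. -/
theorem HasCertificate.of_family [Fintype V] {G : SimpleGraph V} {N : ℕ} {s : ℕ → V}
    {γ : ℕ → Config V} {K : ℕ} (A : Finset (ℕ × ℕ)) (w : ℕ × ℕ → V) (L R : Finset ℕ)
    (hL : ∀ q ∈ L, q < N) (hR : ∀ p ∈ R, p < N) (hcard : L.card + R.card < K * A.card)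
    (hA : ∀ a ∈ A, IsArc N s a.1 a.2 ∧ G.Adj (s a.1) (w a) ∧ γ a.1 (w a) ≠ γ a.2 (w a))
    (hdiag : ∀ a ∈ A, ∀ b ∈ A, a ≠ b → s b.1 = s a.1 → γ b.1 (w a) = γ b.2 (w a))
    (hcov : ∀ a ∈ A, ∀ u, G.Adj (s a.1) u → γ a.1 u ≠ γ a.2 u →
      (∃ q ∈ L, s q = u ∧ a.1 ≤ q ∧ ∀ z, a.1 ≤ z → z < q → s z ≠ u) ∧
      ∃ p ∈ R, s p = u ∧ p < a.2 ∧ ∀ z, p < z → z < a.2 → s z ≠ u) :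
    HasCertificate G N s γ (4 * K) := by
  obtain ⟨S, B, hBA, hB, hS⟩ := exists_set_separating A (fun a => s a.1) w
    fun a ha => (hA a ha).2.1.ne
  have hle : K * A.card ≤ 4 * K * B.card := by
    calc K * A.card ≤ K * (4 * B.card) := Nat.mul_le_mul_left _ hB
      _ = _ := by ring
  refine ⟨B, w, L, R, ?_, hL, hR, by omega, fun a ha => hA a (hBA ha), ?_,
    fun a ha => hcov a (hBA ha)⟩
  · rw [Finset.nonempty_iff_ne_empty]
    rintro rfl
    simp at hle
    rcases hle with rfl | rfl <;> simp at hcard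
  · intro a ha b hb hab
    refine ⟨fun he => (hS a ha).2 (he ▸ (hS b hb).1), hdiag a (hBA ha) b (hBA hb) hab⟩

theorem HasCertificate.mono {G : SimpleGraph V} {N : ℕ} {s : ℕ → V} {γ : ℕ → Config V} {K K' : ℕ}
    (h : HasCertificate G N s γ K) (hK : K ≤ K') : HasCertificate G N s γ K' := by
  obtain ⟨A, w, L, R, h1, h2, h3, h4, h5⟩ := h
  exact ⟨A, w, L, R, h1, h2, h3, h4.trans (Nat.mul_le_mul_right _ hK), h5⟩

end Trajectory

/-! ### Rarity of repeated nodes and light arcs, and double counting over windows -/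

section Windows

variable {V : Type u}

open scoped Classical in
/-- The nodes that move at least twice in the window `[a, b)`. -/
noncomputable def repeated [Fintype V] (N : ℕ) (s : ℕ → V) (a b : ℕ) : Finset V :=
  Finset.univ.filter fun v => ∃ x y, a ≤ x ∧ x < y ∧ y < b ∧ y < N ∧ s x = v ∧ s y = v

/-- Some neighbour of the node of the arc `(i, j)` changes its state along the arc, and moves only
once in the window `[a, b)`. -/
def IsLight (G : SimpleGraph V) (N : ℕ) (s : ℕ → V) (γ : ℕ → Config V) (a b i j : ℕ) : Prop :=
  ∃ u, G.Adj (s i) u ∧ γ i u ≠ γ j u ∧ ∀ x y, a ≤ x → x < b → x < N → a ≤ y → y < b → y < N →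
    s x = u → s y = u → x = y

open scoped Classical in
/-- The light arcs inside the window `[a, b)`. -/
noncomputable def lightArcs (G : SimpleGraph V) (N : ℕ) (s : ℕ → V) (γ : ℕ → Config V) (a b : ℕ) :
    Finset (ℕ × ℕ) :=
  (arcs N s).filter fun c => a ≤ c.1 ∧ c.2 < b ∧ IsLight G N s γ a b c.1 c.2

/-- All moves of the window serve both as `L` and as `R`: the first and the last move of a changed
neighbour along an arc lie in the window. The factor 8 is 2 for the two lists times 4 for the
separation. -/
theorem HasCertificate.of_window [Fintype V] {G : SimpleGraph V} {N : ℕ} {s : ℕ → V}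
    {γ : ℕ → Config V} (hγ : IsTrajectory N s γ) {c a b : ℕ} (A : Finset (ℕ × ℕ)) (w : ℕ × ℕ → V)
    (hab : ∀ e ∈ A, a ≤ e.1 ∧ e.2 < b)
    (hcard : (Finset.Ico a (min b N)).card < c * A.card)
    (hA : ∀ a ∈ A, IsArc N s a.1 a.2 ∧ G.Adj (s a.1) (w a) ∧ γ a.1 (w a) ≠ γ a.2 (w a))
    (hdiag : ∀ a ∈ A, ∀ b ∈ A, a ≠ b → s b.1 = s a.1 → γ b.1 (w a) = γ b.2 (w a)) :
    HasCertificate G N s γ (8 * c) := by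
  have : HasCertificate G N s γ (4 * (2 * c)) := by
    refine HasCertificate.of_family A w (Finset.Ico a (min b N)) (Finset.Ico a (min b N)) ?_ ?_ ?_
      hA hdiag ?_
    · intro q hq
      simp only [Finset.mem_Ico, lt_min_iff] at hq
      exact hq.2.2
    · intro q hq
      simp only [Finset.mem_Ico, lt_min_iff] at hq
      exact hq.2.2
    · rw [mul_assoc]
      omega
    · intro e he u _ hu
      obtain ⟨h1, h2⟩ := hab e he
      obtain ⟨⟨h3, h4, h5, h6⟩, -, -⟩ := hA e he
      obtain ⟨x, hx, hx', hsx⟩ := hγ.exists_of_ne h3.le h4.le hu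
      constructor
      · obtain ⟨q, hq1, hq2, hq3, hq4⟩ := exists_first_ge (P := fun k => s k = u) hx hsx
        refine ⟨q, ?_, hq3, hq1, hq4⟩
        simp only [Finset.mem_Ico, lt_min_iff]
        omega
      · obtain ⟨p, hp1, hp2, hp3⟩ := exists_last_lt (P := fun k => s k = u) ⟨x, hx', hsx⟩
        have : x ≤ p := by
          by_contra hc
          exact hp3 x (by omega) hx' hsx
        refine ⟨p, ?_, hp2, hp1, hp3⟩
        simp only [Finset.mem_Ico, lt_min_iff]
        omega
  convert this using 1
  ring

/-- Otherwise one arc for each repeated node would give a certificate: these arcs have distinct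
nodes, so none of them clash. -/
theorem card_repeated_le [Fintype V] {G : SimpleGraph V} {N : ℕ} {s : ℕ → V}
    {γ : ℕ → Config V} (hγ : IsTrajectory N s γ)
    (hval : ∀ i j, IsArc N s i j → ∃ u, G.Adj (s i) u ∧ γ i u ≠ γ j u) {c : ℕ}
    (hno : ¬ HasCertificate G N s γ (8 * c)) (a b : ℕ) :
    c * (repeated N s a b).card ≤ (Finset.Ico a (min b N)).card := by
  classical
  by_contra! hc
  refine hno ?_
  have hex : ∀ v ∈ repeated N s a b, ∃ e : ℕ × ℕ, IsArc N s e.1 e.2 ∧ a ≤ e.1 ∧ e.2 < b ∧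
      s e.1 = v := by
    intro v hv
    simp only [repeated, Finset.mem_filter, Finset.mem_univ, true_and] at hv
    obtain ⟨x, y, h1, h2, h3, h4, h5, h6⟩ := hv
    obtain ⟨i, hi, hij⟩ := exists_isArc_left h4 h2 (h5.trans h6.symm)
    exact ⟨(i, y), hij, by simp; omega, h3, hij.2.2.1.trans h6⟩
  choose! e he using hex
  have hex' : ∀ a : ℕ × ℕ, IsArc N s a.1 a.2 → ∃ u, G.Adj (s a.1) u ∧ γ a.1 u ≠ γ a.2 u :=
    fun a => hval a.1 a.2
  have : Nonempty V := ⟨s 0⟩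
  choose! w hw using hex'
  have hinj : Set.InjOn e (repeated N s a b) := by
    intro v hv v' hv' hvv
    rw [← (he v hv).2.2.2, ← (he v' hv').2.2.2, hvv]
  refine HasCertificate.of_window hγ ((repeated N s a b).image e) w ?_ ?_ ?_ ?_ (a := a) (b := b)
  · intro x hx
    obtain ⟨v, hv, rfl⟩ := Finset.mem_image.1 hx
    exact ⟨(he v hv).2.1, (he v hv).2.2.1⟩
  · rwa [Finset.card_image_of_injOn hinj]
  · intro x hx
    obtain ⟨v, hv, rfl⟩ := Finset.mem_image.1 hx
    exact ⟨(he v hv).1, hw _ (he v hv).1⟩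
  · intro x hx y hy hxy hs
    obtain ⟨v, hv, rfl⟩ := Finset.mem_image.1 hx
    obtain ⟨v', hv', rfl⟩ := Finset.mem_image.1 hy
    rw [(he v hv).2.2.2, (he v' hv').2.2.2] at hs
    exact absurd (by rw [hs]) hxy

/-- The witness of a light arc moves only once in the window, so it cannot also change along
another, disjoint arc of the same node. Too many light arcs would thus give a certificate. -/
theorem card_lightArcs_le [Fintype V] {G : SimpleGraph V} {N : ℕ} {s : ℕ → V}
    {γ : ℕ → Config V} (hγ : IsTrajectory N s γ) {c : ℕ}
    (hno : ¬ HasCertificate G N s γ (8 * c)) (a b : ℕ) :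
    c * (lightArcs G N s γ a b).card ≤ (Finset.Ico a (min b N)).card := by
  classical
  by_contra! hc
  refine hno ?_
  have hmem : ∀ e ∈ lightArcs G N s γ a b, IsArc N s e.1 e.2 ∧ a ≤ e.1 ∧ e.2 < b ∧
      IsLight G N s γ a b e.1 e.2 := by
    intro e he
    simp only [lightArcs, Finset.mem_filter, mem_arcs] at he
    exact he
  have hex : ∀ e ∈ lightArcs G N s γ a b, ∃ u, G.Adj (s e.1) u ∧ γ e.1 u ≠ γ e.2 u ∧
      ∀ x y, a ≤ x → x < b → x < N → a ≤ y → y < b → y < N → s x = u → s y = u → x = y :=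
    fun e he => (hmem e he).2.2.2
  have : Nonempty V := ⟨s 0⟩
  choose! w hw using hex
  refine HasCertificate.of_window hγ (lightArcs G N s γ a b) w ?_ hc ?_ ?_ (a := a) (b := b)
  · exact fun e he => ⟨(hmem e he).2.1, (hmem e he).2.2.1⟩
  · exact fun e he => ⟨(hmem e he).1, (hw e he).1, (hw e he).2.1⟩
  · intro e he f hf hef hs
    by_contra hne
    obtain ⟨h1, h2, h3, -⟩ := hmem e he
    obtain ⟨h1', h2', h3', -⟩ := hmem f hf
    obtain ⟨-, hwe, hun⟩ := hw e he
    obtain ⟨x, hx, hx', hsx⟩ := hγ.exists_of_ne h1.1.le h1.2.1.le hwe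
    obtain ⟨y, hy, hy', hsy⟩ := hγ.exists_of_ne h1'.1.le h1'.2.1.le hne
    have hN := h1.2.1
    have hN' := h1'.2.1
    have hxy := hun x y (by omega) (by omega) (by omega) (by omega) (by omega) (by omega) hsx hsy
    have hne1 : e.1 ≠ f.1 := by
      intro h11
      have := h1.right_unique (j' := f.2) (by rw [h11]; exact h1')
      exact hef (Prod.ext h11 this)
    rcases h1.le_or_le h1' hs hne1 with h | h <;> omega

/-- Double counting of pairs `x z < y z` in the windows of length `L`. -/
theorem mul_card_le_of_windows {ζ : Type*} (Z : Finset ζ) (x y : ζ → ℕ) {N L c : ℕ} (hL : 0 < L)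
    (h1 : ∀ z ∈ Z, x z < y z ∧ y z < N ∧ 2 * (y z - x z) ≤ L)
    (h2 : ∀ t, c * (Z.filter fun z => y z < t ∧ t ≤ x z + L).card ≤
      (Finset.Ico (t - L) (min t N)).card) :
    c * Z.card ≤ 2 * N := by
  classical
  have e1 := Finset.sum_card_bipartiteAbove_eq_sum_card_bipartiteBelow
    (s := Finset.range (N + L)) (t := Z) (fun t z => y z < t ∧ t ≤ x z + L)
  have e2 := Finset.sum_card_bipartiteAbove_eq_sum_card_bipartiteBelow
    (s := Finset.range (N + L)) (t := Finset.range N) (fun t p => t - L ≤ p ∧ p < t)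
  simp only [Finset.bipartiteAbove, Finset.bipartiteBelow] at e1 e2
  -- Each pair is counted in `L - (y z - x z) ≥ L / 2` of the windows `[t - L, t)`, whereas by `b2`
  -- each time lies in at most `L` of them.
  have b1 : Z.card * L ≤
      2 * ∑ z ∈ Z, ((Finset.range (N + L)).filter fun t => y z < t ∧ t ≤ x z + L).card := by
    rw [Finset.mul_sum, ← smul_eq_mul, ← Finset.sum_const]
    refine Finset.sum_le_sum fun z hz => ?_
    obtain ⟨hxy, hyN, hxL⟩ := h1 z hz
    have : Finset.Ioc (y z) (x z + L) ⊆
        (Finset.range (N + L)).filter fun t => y z < t ∧ t ≤ x z + L := by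
      intro t ht
      simp only [Finset.mem_Ioc] at ht
      simp only [Finset.mem_filter, Finset.mem_range]
      omega
    have := Finset.card_le_card this
    rw [Nat.card_Ioc] at this
    omega
  have b2 : ∑ p ∈ Finset.range N, ((Finset.range (N + L)).filter
      fun t => t - L ≤ p ∧ p < t).card ≤ N * L := by
    calc _ ≤ ∑ p ∈ Finset.range N, L := by
          refine Finset.sum_le_sum fun p _ => ?_
          have : ((Finset.range (N + L)).filter fun t => t - L ≤ p ∧ p < t) ⊆
              Finset.Ioc p (p + L) := by
            intro t ht
            simp only [Finset.mem_filter, Finset.mem_range] at ht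
            simp only [Finset.mem_Ioc]
            omega
          have := Finset.card_le_card this
          rw [Nat.card_Ioc] at this
          omega
      _ = N * L := by simp
  have b3 : c * ∑ t ∈ Finset.range (N + L), (Z.filter fun z => y z < t ∧ t ≤ x z + L).card ≤
      ∑ t ∈ Finset.range (N + L), ((Finset.range N).filter fun p => t - L ≤ p ∧ p < t).card := by
    rw [Finset.mul_sum]
    refine Finset.sum_le_sum fun t _ => (h2 t).trans (Finset.card_le_card ?_)
    intro p hp
    simp only [Finset.mem_Ico, lt_min_iff] at hp
    simp only [Finset.mem_filter, Finset.mem_range]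
    omega
  rw [e1, e2] at b3
  refine Nat.le_of_mul_le_mul_right (c := L) ?_ hL
  calc c * Z.card * L = c * (Z.card * L) := by ring
    _ ≤ c * (2 * _) := Nat.mul_le_mul_left _ b1
    _ = 2 * (c * _) := by ring
    _ ≤ 2 * (N * L) := Nat.mul_le_mul_left _ (b3.trans b2)
    _ = 2 * N * L := by ring

/-- If every item is counted at `m` consecutive scales, and at most `2 N / c` items are counted at
any scale, then there are few items. -/
theorem mul_card_le_of_scales {ζ : Type*} (Z : Finset ζ) (l : ζ → ℕ) {N c m T : ℕ}
    (hl : ∀ z ∈ Z, l z < T)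
    (h : ∀ k, c * (Z.filter fun z => l z + 2 ≤ k ∧ k < l z + 2 + m).card ≤ 2 * N) :
    c * (m * Z.card) ≤ 2 * N * (T + m + 1) := by
  classical
  have e1 := Finset.sum_card_bipartiteAbove_eq_sum_card_bipartiteBelow
    (s := Finset.range (T + m + 1)) (t := Z) (fun k z => l z + 2 ≤ k ∧ k < l z + 2 + m)
  simp only [Finset.bipartiteAbove, Finset.bipartiteBelow] at e1
  have b1 : m * Z.card ≤ ∑ z ∈ Z, ((Finset.range (T + m + 1)).filter
      fun k => l z + 2 ≤ k ∧ k < l z + 2 + m).card := by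
    rw [mul_comm, ← smul_eq_mul, ← Finset.sum_const]
    refine Finset.sum_le_sum fun z hz => ?_
    have := hl z hz
    have : Finset.Ico (l z + 2) (l z + 2 + m) ⊆
        (Finset.range (T + m + 1)).filter fun k => l z + 2 ≤ k ∧ k < l z + 2 + m := by
      intro k hk
      simp only [Finset.mem_Ico] at hk
      simp only [Finset.mem_filter, Finset.mem_range]
      omega
    have := Finset.card_le_card this
    rw [Nat.card_Ico] at this
    omega
  calc c * (m * Z.card) ≤ c * _ := Nat.mul_le_mul_left _ b1
    _ = ∑ k ∈ Finset.range (T + m + 1),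
        c * (Z.filter fun z => l z + 2 ≤ k ∧ k < l z + 2 + m).card := by
      rw [← e1, Finset.mul_sum]
    _ ≤ ∑ k ∈ Finset.range (T + m + 1), 2 * N := Finset.sum_le_sum fun k _ => h k
    _ = _ := by simp [mul_comm]

end Windows

/-! ### Most arcs are good -/

section BadArcs

variable {V : Type u}

theorem IsLight.anti {G : SimpleGraph V} {N : ℕ} {s : ℕ → V} {γ : ℕ → Config V} {a b a' b' i j : ℕ}
    (h : IsLight G N s γ a b i j) (ha : a ≤ a') (hb : b' ≤ b) : IsLight G N s γ a' b' i j := by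
  obtain ⟨u, h1, h2, h3⟩ := h
  exact ⟨u, h1, h2, fun x y _ _ _ _ _ _ => h3 x y (by omega) (by omega) (by omega) (by omega)
    (by omega) (by omega)⟩

open scoped Classical in
/-- The arcs whose node makes a comparatively recent earlier move. -/
noncomputable def arcsShortBefore (N : ℕ) (s : ℕ → V) (Q : ℕ) : Finset (ℕ × ℕ) :=
  (arcs N s).filter fun a => ∃ h < a.1, s h = s a.1 ∧ (a.1 - h) * 2 ^ Q ≤ a.2 - a.1

open scoped Classical in
/-- The arcs whose node makes a comparatively early later move. -/
noncomputable def arcsShortAfter (N : ℕ) (s : ℕ → V) (Q : ℕ) : Finset (ℕ × ℕ) :=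
  (arcs N s).filter fun a => ∃ h, a.2 < h ∧ h < N ∧ s h = s a.1 ∧ (h - a.2) * 2 ^ Q ≤ a.2 - a.1

open scoped Classical in
/-- The arcs that are light in a comparatively large window. -/
noncomputable def arcsFarLight (G : SimpleGraph V) (N : ℕ) (s : ℕ → V) (γ : ℕ → Config V) (Q : ℕ) :
    Finset (ℕ × ℕ) :=
  (arcs N s).filter fun a => IsLight G N s γ (a.1 - (a.2 - a.1) * 2 ^ Q)
    (a.2 + (a.2 - a.1) * 2 ^ Q + 1) a.1 a.2

theorem log_two_lt {N T x : ℕ} (hT : N ≤ 2 ^ T) (hx : x < N) (h0 : 0 < x) : Nat.log 2 x < T :=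
  Nat.log_lt_of_lt_pow (by omega) (by omega)

/-- These are the `m` scales at which a gap `x` is counted: the window is at least twice as long as
the gap, but at most `2 ^ (m + 1)` times as long, which is the ratio that defines bad arcs. -/
theorem scale_bounds {x k m : ℕ} (hx : 0 < x) (h1 : Nat.log 2 x + 2 ≤ k)
    (h2 : k < Nat.log 2 x + 2 + m) : 2 * x ≤ 2 ^ k ∧ 2 ^ k ≤ x * 2 ^ (m + 1) := by
  have h3 : x < 2 ^ (Nat.log 2 x + 1) := Nat.lt_pow_succ_log_self (by norm_num) x
  have h4 : 2 ^ Nat.log 2 x ≤ x := Nat.pow_log_le_self 2 (by omega)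
  constructor
  · calc 2 * x ≤ 2 ^ (Nat.log 2 x + 2) := by rw [pow_succ 2 (Nat.log 2 x + 1)]; omega
      _ ≤ 2 ^ k := Nat.pow_le_pow_right (by norm_num) h1
  · calc 2 ^ k ≤ 2 ^ (Nat.log 2 x + (m + 1)) := Nat.pow_le_pow_right (by norm_num) (by omega)
      _ = 2 ^ Nat.log 2 x * 2 ^ (m + 1) := pow_add _ _ _
      _ ≤ _ := Nat.mul_le_mul_right _ h4

/-- In a window of length `2 ^ k` containing `h` and `a.1` the node is repeated, and the window is
too short to extend beyond `a.2`. Hence different arcs counted in a window have different nodes.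
Counting each arc at `m` scales gains the factor `m`. -/
theorem card_arcsShortBefore_le [Fintype V] {N : ℕ} {s : ℕ → V} {c m T : ℕ} (hT : N ≤ 2 ^ T)
    (hrep : ∀ a b, c * (repeated N s a b).card ≤ (Finset.Ico a (min b N)).card) :
    c * (m * (arcsShortBefore N s (m + 1)).card) ≤ 2 * N * (T + m + 1) := by
  classical
  have hmem : ∀ a ∈ arcsShortBefore N s (m + 1), IsArc N s a.1 a.2 ∧
      ∃ h < a.1, s h = s a.1 ∧ (a.1 - h) * 2 ^ (m + 1) ≤ a.2 - a.1 := by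
    intro a ha
    simpa only [arcsShortBefore, Finset.mem_filter, mem_arcs] using ha
  choose! harc h hlt hs hle using hmem
  refine mul_card_le_of_scales _ (fun a => Nat.log 2 (a.1 - h a)) ?_ fun k => ?_
  · intro a ha
    have h1 := harc a ha
    have h2 := hlt a ha
    exact log_two_lt hT (by have := h1.1; have := h1.2.1; omega) (by omega)
  · refine mul_card_le_of_windows (L := 2 ^ k) _ h Prod.fst (by positivity) ?_ ?_
    · intro a ha
      rw [Finset.mem_filter] at ha
      obtain ⟨ha, hk1, hk2⟩ := ha
      have h1 := harc a ha
      have h2 := hlt a ha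
      have h3 := scale_bounds (by omega) hk1 hk2
      exact ⟨h2, h1.1.trans h1.2.1, h3.1⟩
    · intro t
      refine (Nat.mul_le_mul_left _ ?_).trans (hrep (t - 2 ^ k) t)
      have hlate : ∀ a ∈ arcsShortBefore N s (m + 1), Nat.log 2 (a.1 - h a) + 2 ≤ k →
          k < Nat.log 2 (a.1 - h a) + 2 + m → t ≤ h a + 2 ^ k → t ≤ a.2 := by
        intro a ha hk1 hk2 ht
        have h1 := hlt a ha
        have h2 := hle a ha
        have h3 := scale_bounds (by omega) hk1 hk2
        omega
      refine Finset.card_le_card_of_injOn (fun a => s a.1) ?_ ?_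
      · intro a ha
        simp only [Finset.coe_filter, Finset.mem_filter, Set.mem_ofPred_eq] at ha
        obtain ⟨⟨ha, hk1, hk2⟩, ht1, ht2⟩ := ha
        have h1 := hlt a ha
        have h2 := harc a ha
        simp only [repeated, Finset.coe_filter, Finset.mem_univ, true_and, Set.mem_ofPred_eq]
        exact ⟨h a, a.1, by omega, h1, ht1, h2.1.trans h2.2.1, hs a ha, rfl⟩
      · intro a ha b hb hab
        simp only [Finset.coe_filter, Finset.mem_filter, Set.mem_ofPred_eq] at ha hb
        obtain ⟨⟨ha, hk1, hk2⟩, ht1, ht2⟩ := ha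
        obtain ⟨⟨hb, hk1', hk2'⟩, ht1', ht2'⟩ := hb
        have e1 := hlate a ha hk1 hk2 ht2
        have e2 := hlate b hb hk1' hk2' ht2'
        by_cases hne : a.1 = b.1
        · refine Prod.ext hne ((harc a ha).right_unique ?_)
          rw [hne]
          exact harc b hb
        · rcases (harc a ha).le_or_le (harc b hb) hab.symm hne with h | h <;> omega

theorem card_arcsShortAfter_le [Fintype V] {N : ℕ} {s : ℕ → V} {c m T : ℕ} (hT : N ≤ 2 ^ T)
    (hrep : ∀ a b, c * (repeated N s a b).card ≤ (Finset.Ico a (min b N)).card) :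
    c * (m * (arcsShortAfter N s (m + 1)).card) ≤ 2 * N * (T + m + 1) := by
  classical
  have hmem : ∀ a ∈ arcsShortAfter N s (m + 1), IsArc N s a.1 a.2 ∧
      ∃ h, a.2 < h ∧ h < N ∧ s h = s a.1 ∧ (h - a.2) * 2 ^ (m + 1) ≤ a.2 - a.1 := by
    intro a ha
    simpa only [arcsShortAfter, Finset.mem_filter, mem_arcs] using ha
  choose! harc h hlt hN hs hle using hmem
  refine mul_card_le_of_scales _ (fun a => Nat.log 2 (h a - a.2)) ?_ fun k => ?_
  · intro a ha
    have h1 := hN a ha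
    have h2 := hlt a ha
    exact log_two_lt hT (by omega) (by omega)
  · refine mul_card_le_of_windows (L := 2 ^ k) _ Prod.snd h (by positivity) ?_ ?_
    · intro a ha
      rw [Finset.mem_filter] at ha
      obtain ⟨ha, hk1, hk2⟩ := ha
      have h2 := hlt a ha
      have h3 := scale_bounds (by omega) hk1 hk2
      exact ⟨h2, hN a ha, h3.1⟩
    · intro t
      refine (Nat.mul_le_mul_left _ ?_).trans (hrep (t - 2 ^ k) t)
      have hearly : ∀ a ∈ arcsShortAfter N s (m + 1), Nat.log 2 (h a - a.2) + 2 ≤ k →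
          k < Nat.log 2 (h a - a.2) + 2 + m → h a < t → a.1 < t - 2 ^ k := by
        intro a ha hk1 hk2 ht
        have h1 := hlt a ha
        have h2 := hle a ha
        have h3 := scale_bounds (by omega) hk1 hk2
        have h4 := (harc a ha).1
        omega
      refine Finset.card_le_card_of_injOn (fun a => s a.1) ?_ ?_
      · intro a ha
        simp only [Finset.coe_filter, Finset.mem_filter, Set.mem_ofPred_eq] at ha
        obtain ⟨⟨ha, hk1, hk2⟩, ht1, ht2⟩ := ha
        have h1 := hlt a ha
        have h2 := harc a ha
        simp only [repeated, Finset.coe_filter, Finset.mem_univ, true_and, Set.mem_ofPred_eq]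
        exact ⟨a.2, h a, by omega, h1, ht1, hN a ha, h2.2.2.1.symm, hs a ha⟩
      · intro a ha b hb hab
        simp only [Finset.coe_filter, Finset.mem_filter, Set.mem_ofPred_eq] at ha hb
        obtain ⟨⟨ha, hk1, hk2⟩, ht1, ht2⟩ := ha
        obtain ⟨⟨hb, hk1', hk2'⟩, ht1', ht2'⟩ := hb
        have e1 := hearly a ha hk1 hk2 ht1
        have e2 := hearly b hb hk1' hk2' ht1'
        by_cases hne : a.1 = b.1
        · refine Prod.ext hne ((harc a ha).right_unique ?_)
          rw [hne]
          exact harc b hb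
        · rcases (harc a ha).le_or_le (harc b hb) hab.symm hne with h | h <;> omega

/-- Lightness passes to smaller windows, so such an arc is light in the windows of `m` consecutive
dyadic lengths around it. -/
theorem card_arcsFarLight_le {G : SimpleGraph V} {N : ℕ} {s : ℕ → V} {γ : ℕ → Config V}
    {c m T : ℕ} (hT : N ≤ 2 ^ T)
    (hlight : ∀ a b, c * (lightArcs G N s γ a b).card ≤ (Finset.Ico a (min b N)).card) :
    c * (m * (arcsFarLight G N s γ (m + 1)).card) ≤ 2 * N * (T + m + 1) := by
  classical
  have hmem : ∀ a ∈ arcsFarLight G N s γ (m + 1), IsArc N s a.1 a.2 ∧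
      IsLight G N s γ (a.1 - (a.2 - a.1) * 2 ^ (m + 1)) (a.2 + (a.2 - a.1) * 2 ^ (m + 1) + 1)
        a.1 a.2 := by
    intro a ha
    simpa only [arcsFarLight, Finset.mem_filter, mem_arcs] using ha
  choose! harc hli using hmem
  refine mul_card_le_of_scales _ (fun a => Nat.log 2 (a.2 - a.1)) ?_ fun k => ?_
  · intro a ha
    have h1 := harc a ha
    exact log_two_lt hT (by have := h1.1; have := h1.2.1; omega) (by have := h1.1; omega)
  · refine mul_card_le_of_windows (L := 2 ^ k) _ Prod.fst Prod.snd (by positivity) ?_ ?_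
    · intro a ha
      rw [Finset.mem_filter] at ha
      obtain ⟨ha, hk1, hk2⟩ := ha
      have h1 := harc a ha
      have h3 := scale_bounds (by have := h1.1; omega) hk1 hk2
      exact ⟨h1.1, h1.2.1, h3.1⟩
    · intro t
      refine (Nat.mul_le_mul_left _ (Finset.card_le_card ?_)).trans (hlight (t - 2 ^ k) t)
      intro a ha
      simp only [Finset.mem_filter] at ha
      obtain ⟨⟨ha, hk1, hk2⟩, ht1, ht2⟩ := ha
      have h1 := harc a ha
      have h3 := scale_bounds (by have := h1.1; omega) hk1 hk2
      have h4 := h1.1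
      simp only [lightArcs, Finset.mem_filter, mem_arcs]
      exact ⟨h1, by omega, ht1, (hli a ha).anti (by omega) (by omega)⟩

open scoped Classical in
/-- The arcs that are neither far light nor long in comparison with a neighbouring arc. -/
noncomputable def goodArcs (G : SimpleGraph V) (N : ℕ) (s : ℕ → V) (γ : ℕ → Config V) (Q : ℕ) :
    Finset (ℕ × ℕ) :=
  arcs N s \ (arcsShortBefore N s Q ∪ arcsShortAfter N s Q ∪ arcsFarLight G N s γ Q)

/-- With `c = 72 m` and `T = m ^ 2` each of the three bad classes has at most `N / 12` arcs, out of
at least `N / 2` arcs in all. -/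
theorem le_card_goodArcs [Fintype V] {G : SimpleGraph V} {N : ℕ} {s : ℕ → V} {γ : ℕ → Config V}
    {m : ℕ} (hm : 0 < m) (hN : N = 2 * Fintype.card V) (hT : N ≤ 2 ^ m ^ 2)
    (hrep : ∀ a b, 72 * m * (repeated N s a b).card ≤ (Finset.Ico a (min b N)).card)
    (hlight : ∀ a b, 72 * m * (lightArcs G N s γ a b).card ≤ (Finset.Ico a (min b N)).card) :
    N ≤ 4 * (goodArcs G N s γ (m + 1)).card := by
  classical
  have key : ∀ x : ℕ, 72 * m * (m * x) ≤ 2 * N * (m ^ 2 + m + 1) → 12 * x ≤ N := by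
    intro x hx
    have h1 : m ^ 2 + m + 1 ≤ 3 * m ^ 2 := by nlinarith
    have h2 : (m ^ 2 * 6) * (12 * x) ≤ (m ^ 2 * 6) * N := by
      calc (m ^ 2 * 6) * (12 * x) = 72 * m * (m * x) := by ring
        _ ≤ 2 * N * (m ^ 2 + m + 1) := hx
        _ ≤ 2 * N * (3 * m ^ 2) := Nat.mul_le_mul_left _ h1
        _ = _ := by ring
    exact Nat.le_of_mul_le_mul_left h2 (by positivity)
  have h1 := key _ (card_arcsShortBefore_le hT hrep)
  have h2 := key _ (card_arcsShortAfter_le hT hrep)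
  have h3 := key _ (card_arcsFarLight_le hT hlight)
  have h4 := le_card_arcs_add_card N s
  have h5 := Finset.le_card_sdiff
    (arcsShortBefore N s (m + 1) ∪ arcsShortAfter N s (m + 1) ∪ arcsFarLight G N s γ (m + 1))
    (arcs N s)
  have h6 := Finset.card_union_le
    (arcsShortBefore N s (m + 1) ∪ arcsShortAfter N s (m + 1)) (arcsFarLight G N s γ (m + 1))
  have h7 := Finset.card_union_le (arcsShortBefore N s (m + 1)) (arcsShortAfter N s (m + 1))
  have h8 : (goodArcs G N s γ (m + 1)).card = (arcs N s \ (arcsShortBefore N s (m + 1) ∪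
    arcsShortAfter N s (m + 1) ∪ arcsFarLight G N s γ (m + 1))).card := by
    rw [goodArcs]
  omega

end BadArcs

/-! ### The moves to be recorded at a given scale -/

section Scale

variable {V : Type u}

open scoped Classical in
/-- The arcs whose length is comparable with `2 ^ k`. -/
noncomputable def longArcs (N : ℕ) (s : ℕ → V) (Q k : ℕ) : Finset (ℕ × ℕ) :=
  (arcs N s).filter fun a => 2 ^ k < (a.2 - a.1) * 2 ^ (Q + 2) ∧ a.2 - a.1 ≤ 2 ^ (k + Q + 2)

open scoped Classical in
/-- The arcs that are much shorter than `2 ^ k`, and light at a scale somewhat below `2 ^ k`. -/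
noncomputable def shortLightArcs (G : SimpleGraph V) (N : ℕ) (s : ℕ → V) (γ : ℕ → Config V)
    (Q k : ℕ) : Finset (ℕ × ℕ) :=
  (arcs N s).filter fun a => (a.2 - a.1) * 2 ^ (Q + 2) ≤ 2 ^ k ∧
    IsLight G N s γ (a.1 - 2 * 2 ^ (k - (Q + 2))) (a.2 + 2 * 2 ^ (k - (Q + 2)) + 1) a.1 a.2

open scoped Classical in
/-- The arcs that are much shorter than `2 ^ k` and start after a long break. -/
noncomputable def shortFirstArcs (N : ℕ) (s : ℕ → V) (Q k : ℕ) : Finset (ℕ × ℕ) :=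
  (arcs N s).filter fun a => (a.2 - a.1) * 2 ^ (Q + 2) ≤ 2 ^ k ∧
    ∀ h < a.1, s h = s a.1 → 2 ^ (k + 1) < a.1 - h

open scoped Classical in
/-- The arcs that are much shorter than `2 ^ k` and end before a long break. -/
noncomputable def shortLastArcs (N : ℕ) (s : ℕ → V) (Q k : ℕ) : Finset (ℕ × ℕ) :=
  (arcs N s).filter fun a => (a.2 - a.1) * 2 ^ (Q + 2) ≤ 2 ^ k ∧
    ∀ h, a.2 < h → h < N → s h = s a.1 → 2 ^ (k + 1) < h - a.2

theorem short_bounds {x Q k : ℕ} (hx : 0 < x) (h : x * 2 ^ (Q + 2) ≤ 2 ^ k) :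
    2 ^ (k - (Q + 2)) * 2 ^ (Q + 2) = 2 ^ k ∧ x ≤ 2 ^ (k - (Q + 2)) := by
  have h1 : 2 ^ (Q + 2) ≤ 2 ^ k := le_trans (Nat.le_mul_of_pos_left _ hx) h
  have h2 : Q + 2 ≤ k := (Nat.pow_le_pow_iff_right (by norm_num)).1 h1
  have h3 : 2 ^ (k - (Q + 2)) * 2 ^ (Q + 2) = 2 ^ k := by rw [← pow_add]; congr 1; omega
  refine ⟨h3, ?_⟩
  rw [← h3] at h
  exact Nat.le_of_mul_le_mul_right h (by positivity)

theorem card_shortLightArcs_le {G : SimpleGraph V} {N : ℕ} {s : ℕ → V} {γ : ℕ → Config V}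
    {c : ℕ} (Q k : ℕ)
    (hlight : ∀ a b, c * (lightArcs G N s γ a b).card ≤ (Finset.Ico a (min b N)).card) :
    c * (shortLightArcs G N s γ Q k).card ≤ 2 * N := by
  classical
  have hmem : ∀ a ∈ shortLightArcs G N s γ Q k, IsArc N s a.1 a.2 ∧
      (a.2 - a.1) * 2 ^ (Q + 2) ≤ 2 ^ k ∧
      IsLight G N s γ (a.1 - 2 * 2 ^ (k - (Q + 2))) (a.2 + 2 * 2 ^ (k - (Q + 2)) + 1) a.1 a.2 := by
    intro a ha
    simpa only [shortLightArcs, Finset.mem_filter, mem_arcs] using ha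
  refine mul_card_le_of_windows (L := 2 * 2 ^ (k - (Q + 2))) _ Prod.fst Prod.snd (by positivity)
    ?_ ?_
  · intro a ha
    obtain ⟨h1, h2, -⟩ := hmem a ha
    have h3 := short_bounds (by have := h1.1; omega) h2
    exact ⟨h1.1, h1.2.1, by omega⟩
  · intro t
    refine (Nat.mul_le_mul_left _ (Finset.card_le_card ?_)).trans (hlight _ t)
    intro a ha
    simp only [Finset.mem_filter] at ha
    obtain ⟨ha, ht1, ht2⟩ := ha
    obtain ⟨h1, h2, h3⟩ := hmem a ha
    have h4 := h1.1
    simp only [lightArcs, Finset.mem_filter, mem_arcs]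
    exact ⟨h1, by omega, ht1, h3.anti (by omega) (by omega)⟩

/-- A window of length `2 ^ (k + 1)` contains at most one such arc of each node, because of the
break before it, and that node is repeated in the window. -/
theorem card_shortFirstArcs_le [Fintype V] {N : ℕ} {s : ℕ → V} {c : ℕ} (Q k : ℕ)
    (hrep : ∀ a b, c * (repeated N s a b).card ≤ (Finset.Ico a (min b N)).card) :
    c * (shortFirstArcs N s Q k).card ≤ 2 * N := by
  classical
  have hmem : ∀ a ∈ shortFirstArcs N s Q k, IsArc N s a.1 a.2 ∧
      (a.2 - a.1) * 2 ^ (Q + 2) ≤ 2 ^ k ∧ ∀ h < a.1, s h = s a.1 → 2 ^ (k + 1) < a.1 - h := by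
    intro a ha
    simpa only [shortFirstArcs, Finset.mem_filter, mem_arcs] using ha
  refine mul_card_le_of_windows (L := 2 ^ (k + 1)) _ Prod.fst Prod.snd (by positivity) ?_ ?_
  · intro a ha
    obtain ⟨h1, h2, -⟩ := hmem a ha
    have h3 : (a.2 - a.1) * 1 ≤ (a.2 - a.1) * 2 ^ (Q + 2) :=
      Nat.mul_le_mul_left _ Nat.one_le_two_pow
    have h4 : 2 ^ (k + 1) = 2 * 2 ^ k := by ring
    exact ⟨h1.1, h1.2.1, by omega⟩
  · intro t
    refine (Nat.mul_le_mul_left _ ?_).trans (hrep (t - 2 ^ (k + 1)) t)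
    refine Finset.card_le_card_of_injOn (fun a => s a.1) ?_ ?_
    · intro a ha
      simp only [Finset.coe_filter, Set.mem_ofPred_eq] at ha
      obtain ⟨ha, ht1, ht2⟩ := ha
      obtain ⟨h1, h2, h3⟩ := hmem a ha
      simp only [repeated, Finset.coe_filter, Finset.mem_univ, true_and, Set.mem_ofPred_eq]
      exact ⟨a.1, a.2, by omega, h1.1, ht1, h1.2.1, rfl, h1.2.2.1.symm⟩
    · intro a ha b hb hab
      simp only [Finset.coe_filter, Set.mem_ofPred_eq] at ha hb
      obtain ⟨ha, ht1, ht2⟩ := ha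
      obtain ⟨hb, ht1', ht2'⟩ := hb
      obtain ⟨h1, -, h3⟩ := hmem a ha
      obtain ⟨h1', -, h3'⟩ := hmem b hb
      have e1 := h1.1
      have e2 := h1'.1
      rcases lt_trichotomy a.1 b.1 with hlt | heq | hlt
      · have := h3' a.1 hlt hab
        omega
      · refine Prod.ext heq (h1.right_unique ?_)
        rw [heq]
        exact h1'
      · have := h3 b.1 hlt hab.symm
        omega

theorem card_shortLastArcs_le [Fintype V] {N : ℕ} {s : ℕ → V} {c : ℕ} (Q k : ℕ)
    (hrep : ∀ a b, c * (repeated N s a b).card ≤ (Finset.Ico a (min b N)).card) :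
    c * (shortLastArcs N s Q k).card ≤ 2 * N := by
  classical
  have hmem : ∀ a ∈ shortLastArcs N s Q k, IsArc N s a.1 a.2 ∧
      (a.2 - a.1) * 2 ^ (Q + 2) ≤ 2 ^ k ∧
      ∀ h, a.2 < h → h < N → s h = s a.1 → 2 ^ (k + 1) < h - a.2 := by
    intro a ha
    simpa only [shortLastArcs, Finset.mem_filter, mem_arcs] using ha
  refine mul_card_le_of_windows (L := 2 ^ (k + 1)) _ Prod.fst Prod.snd (by positivity) ?_ ?_
  · intro a ha
    obtain ⟨h1, h2, -⟩ := hmem a ha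
    have h3 : (a.2 - a.1) * 1 ≤ (a.2 - a.1) * 2 ^ (Q + 2) :=
      Nat.mul_le_mul_left _ Nat.one_le_two_pow
    have h4 : 2 ^ (k + 1) = 2 * 2 ^ k := by ring
    exact ⟨h1.1, h1.2.1, by omega⟩
  · intro t
    refine (Nat.mul_le_mul_left _ ?_).trans (hrep (t - 2 ^ (k + 1)) t)
    refine Finset.card_le_card_of_injOn (fun a => s a.1) ?_ ?_
    · intro a ha
      simp only [Finset.coe_filter, Set.mem_ofPred_eq] at ha
      obtain ⟨ha, ht1, ht2⟩ := ha
      obtain ⟨h1, h2, h3⟩ := hmem a ha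
      simp only [repeated, Finset.coe_filter, Finset.mem_univ, true_and, Set.mem_ofPred_eq]
      exact ⟨a.1, a.2, by omega, h1.1, ht1, h1.2.1, rfl, h1.2.2.1.symm⟩
    · intro a ha b hb hab
      simp only [Finset.coe_filter, Set.mem_ofPred_eq] at ha hb hab
      obtain ⟨ha, ht1, ht2⟩ := ha
      obtain ⟨hb, ht1', ht2'⟩ := hb
      obtain ⟨h1, -, h3⟩ := hmem a ha
      obtain ⟨h1', -, h3'⟩ := hmem b hb
      have e1 := h1.1
      have e2 := h1'.1
      rcases lt_trichotomy a.2 b.2 with hlt | heq | hlt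
      · have := h3 b.2 hlt h1'.2.1 (by rw [← h1'.2.2.1, hab])
        omega
      · refine Prod.ext (h1.left_unique ?_) heq
        rw [heq]
        exact h1'
      · have := h3' a.2 hlt h1.2.1 (by rw [← h1.2.2.1, hab])
        omega

theorem card_arcs_le (N : ℕ) (s : ℕ → V) : (arcs N s).card ≤ N := by
  calc (arcs N s).card ≤ (Finset.range N).card := by
        refine Finset.card_le_card_of_injOn Prod.snd ?_ ?_
        · intro a ha
          have := (mem_arcs.1 ha).2.1
          simpa using this
        · intro a ha b hb hab
          have h1 := mem_arcs.1 ha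
          have h2 := mem_arcs.1 hb
          refine Prod.ext (h1.left_unique ?_) hab
          rw [hab]
          exact h2
    _ = N := by simp

/-- An arc is comparable with `2 ^ k` only if `k` differs from the logarithm of its length by at
most about `Q + 2`. For `Q = m + 1` these are `O(m)` scales out of `m ^ 2`. -/
theorem sum_card_longArcs_le (N : ℕ) (s : ℕ → V) (Q T : ℕ) :
    ∑ k ∈ Finset.range T, (longArcs N s Q k).card ≤ N * (2 * Q + 6) := by
  classical
  have e1 := Finset.sum_card_bipartiteAbove_eq_sum_card_bipartiteBelow
    (s := Finset.range T) (t := arcs N s)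
    (fun k a => 2 ^ k < (a.2 - a.1) * 2 ^ (Q + 2) ∧ a.2 - a.1 ≤ 2 ^ (k + Q + 2))
  simp only [Finset.bipartiteAbove, Finset.bipartiteBelow] at e1
  have e2 : ∑ k ∈ Finset.range T, (longArcs N s Q k).card = ∑ k ∈ Finset.range T,
      ((arcs N s).filter fun a =>
        2 ^ k < (a.2 - a.1) * 2 ^ (Q + 2) ∧ a.2 - a.1 ≤ 2 ^ (k + Q + 2)).card := by
    refine Finset.sum_congr rfl fun k _ => ?_
    rw [longArcs]
  rw [e2, e1]
  calc _ ≤ ∑ a ∈ arcs N s, (2 * Q + 6) := ?_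
    _ = (arcs N s).card * (2 * Q + 6) := by simp
    _ ≤ _ := Nat.mul_le_mul_right _ (card_arcs_le N s)
  refine Finset.sum_le_sum fun a ha => ?_
  have hpos : 0 < a.2 - a.1 := by
    have := (mem_arcs.1 ha).1
    omega
  have h1 : a.2 - a.1 < 2 ^ (Nat.log 2 (a.2 - a.1) + 1) :=
    Nat.lt_pow_succ_log_self (by norm_num) _
  have h2 : 2 ^ Nat.log 2 (a.2 - a.1) ≤ a.2 - a.1 := Nat.pow_log_le_self 2 (by omega)
  have hsub : ((Finset.range T).filter fun k =>
      2 ^ k < (a.2 - a.1) * 2 ^ (Q + 2) ∧ a.2 - a.1 ≤ 2 ^ (k + Q + 2)) ⊆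
      Finset.Ico (Nat.log 2 (a.2 - a.1) - (Q + 2)) (Nat.log 2 (a.2 - a.1) + Q + 3) := by
    intro k hk
    simp only [Finset.mem_filter, Finset.mem_range] at hk
    obtain ⟨-, hk1, hk2⟩ := hk
    have h3 : 2 ^ k < 2 ^ (Nat.log 2 (a.2 - a.1) + 1 + (Q + 2)) := by
      rw [pow_add 2 (Nat.log 2 (a.2 - a.1) + 1)]
      exact hk1.trans (Nat.mul_lt_mul_of_pos_right h1 (by positivity))
    have h4 := (Nat.pow_lt_pow_iff_right (by norm_num : 1 < 2)).1 h3
    have h5 := (Nat.pow_le_pow_iff_right (by norm_num : 1 < 2)).1 (h2.trans hk2)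
    simp only [Finset.mem_Ico]
    omega
  have := Finset.card_le_card hsub
  rw [Nat.card_Ico] at this
  omega

open scoped Classical in
/-- The moves recorded at scale `k`, from which states of nodes are read off forward. -/
noncomputable def forwardMoves (G : SimpleGraph V) (N : ℕ) (s : ℕ → V) (γ : ℕ → Config V)
    (Q k : ℕ) : Finset ℕ :=
  (longArcs N s Q k ∪ shortLightArcs G N s γ Q k).image Prod.snd ∪
    (longArcs N s Q k ∪ shortFirstArcs N s Q k).image Prod.fst

open scoped Classical in
/-- The moves recorded at scale `k`, from which states of nodes are read off backward. -/
noncomputable def backwardMoves (G : SimpleGraph V) (N : ℕ) (s : ℕ → V) (γ : ℕ → Config V)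
    (Q k : ℕ) : Finset ℕ :=
  (longArcs N s Q k ∪ shortLightArcs G N s γ Q k).image Prod.fst ∪
    (longArcs N s Q k ∪ shortLastArcs N s Q k).image Prod.snd

theorem forwardMoves_lt {G : SimpleGraph V} {N : ℕ} {s : ℕ → V} {γ : ℕ → Config V} {Q k q : ℕ}
    (hq : q ∈ forwardMoves G N s γ Q k) : q < N := by
  simp only [forwardMoves, Finset.mem_union, Finset.mem_image, longArcs, shortLightArcs,
    shortFirstArcs, Finset.mem_filter, mem_arcs] at hq
  rcases hq with ⟨a, ⟨h, -⟩ | ⟨h, -⟩, rfl⟩ | ⟨a, ⟨h, -⟩ | ⟨h, -⟩, rfl⟩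
  exacts [h.2.1, h.2.1, h.1.trans h.2.1, h.1.trans h.2.1]

theorem backwardMoves_lt {G : SimpleGraph V} {N : ℕ} {s : ℕ → V} {γ : ℕ → Config V} {Q k q : ℕ}
    (hq : q ∈ backwardMoves G N s γ Q k) : q < N := by
  simp only [backwardMoves, Finset.mem_union, Finset.mem_image, longArcs, shortLightArcs,
    shortLastArcs, Finset.mem_filter, mem_arcs] at hq
  rcases hq with ⟨a, ⟨h, -⟩ | ⟨h, -⟩, rfl⟩ | ⟨a, ⟨h, -⟩ | ⟨h, -⟩, rfl⟩
  exacts [h.1.trans h.2.1, h.1.trans h.2.1, h.2.1, h.2.1]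

theorem card_recordedMoves_le [Fintype V] {G : SimpleGraph V} {N : ℕ} {s : ℕ → V}
    {γ : ℕ → Config V} {c : ℕ} (Q k : ℕ)
    (hrep : ∀ a b, c * (repeated N s a b).card ≤ (Finset.Ico a (min b N)).card)
    (hlight : ∀ a b, c * (lightArcs G N s γ a b).card ≤ (Finset.Ico a (min b N)).card) :
    c * ((forwardMoves G N s γ Q k).card + (backwardMoves G N s γ Q k).card) ≤
      c * (4 * (longArcs N s Q k).card) + 8 * N := by
  classical
  have h1 := card_shortLightArcs_le Q k hlight
  have h2 := card_shortFirstArcs_le Q k hrep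
  have h3 := card_shortLastArcs_le Q k hrep
  have hu : ∀ A B C D : Finset (ℕ × ℕ), ∀ f g : ℕ × ℕ → ℕ,
      ((A ∪ B).image f ∪ (C ∪ D).image g).card ≤ A.card + B.card + (C.card + D.card) := by
    intro A B C D f g
    exact (Finset.card_union_le _ _).trans (add_le_add
      (Finset.card_image_le.trans (Finset.card_union_le _ _))
      (Finset.card_image_le.trans (Finset.card_union_le _ _)))
  -- Short light arcs are used twice and the other two short classes once; each class has at most `2
  -- * N / c` arcs, whence `8 * N`.
  have h4 : (forwardMoves G N s γ Q k).card + (backwardMoves G N s γ Q k).card ≤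
      4 * (longArcs N s Q k).card + 2 * (shortLightArcs G N s γ Q k).card +
        (shortFirstArcs N s Q k).card + (shortLastArcs N s Q k).card := by
    have := hu (longArcs N s Q k) (shortLightArcs G N s γ Q k) (longArcs N s Q k)
      (shortFirstArcs N s Q k) Prod.snd Prod.fst
    have := hu (longArcs N s Q k) (shortLightArcs G N s γ Q k) (longArcs N s Q k)
      (shortLastArcs N s Q k) Prod.fst Prod.snd
    rw [forwardMoves, backwardMoves]
    omega
  have h5 := Nat.mul_le_mul_left c h4
  simp only [mul_add] at h5 ⊢
  linarith

end Scale

/-! ### Existence of certificates -/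

section Combinatorial

variable {V : Type u}

theorem mem_goodArcs {G : SimpleGraph V} {N : ℕ} {s : ℕ → V} {γ : ℕ → Config V} {Q : ℕ}
    {a : ℕ × ℕ} (h : a ∈ goodArcs G N s γ Q) : IsArc N s a.1 a.2 ∧
      (∀ x < a.1, s x = s a.1 → a.2 - a.1 < (a.1 - x) * 2 ^ Q) ∧
      (∀ x, a.2 < x → x < N → s x = s a.1 → a.2 - a.1 < (x - a.2) * 2 ^ Q) ∧
      ¬ IsLight G N s γ (a.1 - (a.2 - a.1) * 2 ^ Q) (a.2 + (a.2 - a.1) * 2 ^ Q + 1) a.1 a.2 := by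
  simp only [goodArcs, Finset.mem_sdiff, Finset.mem_union, not_or, arcsShortBefore,
    arcsShortAfter, arcsFarLight, Finset.mem_filter, mem_arcs, not_and] at h
  obtain ⟨h1, ⟨h2, h3⟩, h4⟩ := h
  refine ⟨h1, fun x hx hs => ?_, fun x hx hN hs => ?_, h4 h1⟩
  · by_contra hc
    exact h2 h1 ⟨x, hx, hs, not_lt.1 hc⟩
  · by_contra hc
    exact h3 h1 ⟨x, hx, hN, hs, not_lt.1 hc⟩

/-- Let `q` be the first move of `u` from `a.1` on. If `u` moved not long before `q`, the arc ending
at `q` straddles `a.1`; if short, it is light with witness `s a.1`, since goodness isolates the move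
`a.1` of that node. Otherwise, as `a` is not light in its far window, `u` moves there a second time,
necessarily after `q`, so an arc starts at `q`; if short, it follows a long break. -/
theorem exists_mem_forwardMoves {G : SimpleGraph V} {N : ℕ} {s : ℕ → V} {γ : ℕ → Config V}
    (hγ : IsTrajectory N s γ) {Q k : ℕ} {a : ℕ × ℕ} (ha : a ∈ goodArcs G N s γ Q)
    (hk1 : 2 ^ k ≤ a.2 - a.1) (hk2 : a.2 - a.1 < 2 ^ (k + 1)) {u : V} (hadj : G.Adj (s a.1) u)
    (hu : γ a.1 u ≠ γ a.2 u) :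
    ∃ q ∈ forwardMoves G N s γ Q k, s q = u ∧ a.1 ≤ q ∧ q < a.2 ∧
      ∀ z, a.1 ≤ z → z < q → s z ≠ u := by
  obtain ⟨⟨hij, hjN, hsij, harc⟩, hbefore, -, hnl⟩ := mem_goodArcs ha
  obtain ⟨x, hx, hxj, hsx⟩ := hγ.exists_of_ne hij.le hjN.le hu
  obtain ⟨q, hiq, hqx, hsq, hmin⟩ := exists_first_ge (P := fun k => s k = u) hx hsx
  refine ⟨q, ?_, hsq, hiq, by omega, hmin⟩
  have hne : s a.1 ≠ u := hadj.ne
  have hiq' : a.1 < q := lt_of_le_of_ne hiq fun h => hne (by rw [h, hsq])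
  simp only [forwardMoves, Finset.mem_union, Finset.mem_image, longArcs, shortLightArcs,
    shortFirstArcs, Finset.mem_filter, mem_arcs]
  by_cases hp : ∃ p < q, s p = u ∧ q - p ≤ 2 ^ (k + Q + 2)
  · left
    obtain ⟨p, hpq, hsp, hlen⟩ := hp
    obtain ⟨p', hpp', hp'⟩ := exists_isArc_left (by omega : q < N) hpq (hsp.trans hsq.symm)
    have hp'q := hp'.1
    have hsp' : s p' = u := hp'.2.2.1.trans hsq
    have hp'i : p' < a.1 := by
      by_contra hc
      exact hmin p' (by omega) hp'q hsp'
    refine ⟨(p', q), ?_, rfl⟩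
    by_cases hlong : 2 ^ k < (q - p') * 2 ^ (Q + 2)
    · exact Or.inl ⟨hp', hlong, by simp only; omega⟩
    · right
      have hshort := not_lt.1 hlong
      obtain ⟨hl1, hl2⟩ := short_bounds (by omega) hshort
      set l := 2 ^ (k - (Q + 2)) with hl
      have hl3 : l * 2 ^ Q * 4 = 2 ^ k := by rw [← hl1]; ring
      have hl4 : l * 1 ≤ l * 2 ^ Q := Nat.mul_le_mul_left _ Nat.one_le_two_pow
      -- Such a `y` is within `3 * l` of `a.1`, and `3 * l * 2 ^ Q < 2 ^ k ≤ a.2 - a.1`. Before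
      -- `a.1` this contradicts goodness; after `a.1` the node is at rest until `a.2`.
      have huniq : ∀ y, p' - 2 * l ≤ y → y < q + 2 * l + 1 → y < N → s y = s a.1 → y = a.1 := by
        intro y hy1 hy2 hyN hsy
        rcases lt_trichotomy y a.1 with hlt | heq | hlt
        · have h1 := hbefore y hlt hsy
          have h2 : (a.1 - y) * 2 ^ Q ≤ (3 * l) * 2 ^ Q := Nat.mul_le_mul_right _ (by omega)
          have h3 : (3 * l) * 2 ^ Q = 3 * (l * 2 ^ Q) := by ring
          omega
        · exact heq
        · have h1 : a.2 ≤ y := by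
            by_contra hc
            exact harc y hlt (by omega) hsy
          omega
      refine ⟨hp', hshort, s a.1, ?_, ?_, ?_⟩
      · simp only [hsp']
        exact hadj.symm
      · refine hγ.ne_of_unique hp'i.le hiq' (by omega) rfl fun y hy1 hy2 hsy => ?_
        exact huniq y (by omega) (by omega) (by omega) hsy
      · intro y z hy1 hy2 hyN hz1 hz2 hzN hsy hsz
        rw [huniq y hy1 hy2 hyN hsy, huniq z hz1 hz2 hzN hsz]
  · right
    push Not at hp
    have hbig : (a.2 - a.1) + (a.2 - a.1) * 2 ^ Q ≤ 2 ^ (k + Q + 2) := by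
      have h1 : (a.2 - a.1) * 1 ≤ (a.2 - a.1) * 2 ^ Q := Nat.mul_le_mul_left _ Nat.one_le_two_pow
      have h2 : (a.2 - a.1) * 2 ^ Q ≤ 2 ^ (k + 1) * 2 ^ Q := Nat.mul_le_mul_right _ hk2.le
      have h3 : 2 ^ (k + Q + 2) = 2 * (2 ^ (k + 1) * 2 ^ Q) := by ring
      omega
    obtain ⟨y, hy1, hy2, hyN, hsy, hyq⟩ : ∃ y, a.1 - (a.2 - a.1) * 2 ^ Q ≤ y ∧
        y < a.2 + (a.2 - a.1) * 2 ^ Q + 1 ∧ y < N ∧ s y = u ∧ y ≠ q := by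
      by_contra! hc
      refine hnl ⟨u, hadj, hu, fun y z hy1 hy2 hyN hz1 hz2 hzN hsy hsz => ?_⟩
      rw [hc y hy1 hy2 hyN hsy, hc z hz1 hz2 hzN hsz]
    have hqy : q < y := by
      by_contra hc
      have := hp y (by omega) hsy
      omega
    obtain ⟨q', hq'y, hq'⟩ := exists_isArc_right hyN hqy (hsy.trans hsq.symm)
    refine ⟨(q, q'), ?_, rfl⟩
    by_cases hlong : 2 ^ k < (q' - q) * 2 ^ (Q + 2)
    · exact Or.inl ⟨hq', hlong, by simp only; omega⟩
    · refine Or.inr ⟨hq', not_lt.1 hlong, fun h hh hsh => ?_⟩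
      have h1 := hp h hh (hsh.trans hsq)
      have h2 : 2 ^ (k + 1) ≤ 2 ^ (k + Q + 2) := Nat.pow_le_pow_right (by norm_num) (by omega)
      simp only
      omega

/-- Time reversal of `exists_mem_forwardMoves`: `p` is the last move of `u` before `a.2`, and the
isolated move of the node is `a.2`. -/
theorem exists_mem_backwardMoves {G : SimpleGraph V} {N : ℕ} {s : ℕ → V} {γ : ℕ → Config V}
    (hγ : IsTrajectory N s γ) {Q k : ℕ} {a : ℕ × ℕ} (ha : a ∈ goodArcs G N s γ Q)
    (hk1 : 2 ^ k ≤ a.2 - a.1) (hk2 : a.2 - a.1 < 2 ^ (k + 1)) {u : V} (hadj : G.Adj (s a.1) u)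
    (hu : γ a.1 u ≠ γ a.2 u) :
    ∃ p ∈ backwardMoves G N s γ Q k, s p = u ∧ a.1 ≤ p ∧ p < a.2 ∧
      ∀ z, p < z → z < a.2 → s z ≠ u := by
  obtain ⟨⟨hij, hjN, hsij, harc⟩, -, hafter, hnl⟩ := mem_goodArcs ha
  obtain ⟨x, hx, hxj, hsx⟩ := hγ.exists_of_ne hij.le hjN.le hu
  obtain ⟨p, hpj, hsp, hmax⟩ := exists_last_lt (P := fun k => s k = u) ⟨x, hxj, hsx⟩
  have hxp : x ≤ p := by
    by_contra hc
    exact hmax x (by omega) hxj hsx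
  refine ⟨p, ?_, hsp, by omega, hpj, hmax⟩
  have hne : s a.2 ≠ u := by rw [← hsij]; exact hadj.ne
  simp only [backwardMoves, Finset.mem_union, Finset.mem_image, longArcs, shortLightArcs,
    shortLastArcs, Finset.mem_filter, mem_arcs]
  by_cases hq : ∃ q, p < q ∧ q < N ∧ s q = u ∧ q - p ≤ 2 ^ (k + Q + 2)
  · left
    obtain ⟨q, hpq, hqN, hsq, hlen⟩ := hq
    obtain ⟨q', hqq', hq'⟩ := exists_isArc_right hqN hpq (hsq.trans hsp.symm)
    have hpq' := hq'.1
    have hq'N := hq'.2.1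
    have hsq' : s q' = u := hq'.2.2.1.symm.trans hsp
    have hjq' : a.2 < q' := by
      by_contra hc
      rcases eq_or_lt_of_le (not_lt.1 hc) with h | h
      · exact hne (by rw [← h, hsq'])
      · exact hmax q' hpq' h hsq'
    refine ⟨(p, q'), ?_, rfl⟩
    by_cases hlong : 2 ^ k < (q' - p) * 2 ^ (Q + 2)
    · exact Or.inl ⟨hq', hlong, by simp only; omega⟩
    · right
      have hshort := not_lt.1 hlong
      obtain ⟨hl1, hl2⟩ := short_bounds (by omega) hshort
      set l := 2 ^ (k - (Q + 2)) with hl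
      have hl3 : l * 2 ^ Q * 4 = 2 ^ k := by rw [← hl1]; ring
      have hl4 : l * 1 ≤ l * 2 ^ Q := Nat.mul_le_mul_left _ Nat.one_le_two_pow
      have huniq : ∀ y, p - 2 * l ≤ y → y < q' + 2 * l + 1 → y < N → s y = s a.1 → y = a.2 := by
        intro y hy1 hy2 hyN hsy
        rcases lt_trichotomy y a.2 with hlt | heq | hlt
        · have h1 : y ≤ a.1 := by
            by_contra hc
            exact harc y (by omega) hlt hsy
          omega
        · exact heq
        · have h1 := hafter y hlt hyN hsy
          have h2 : (y - a.2) * 2 ^ Q ≤ (3 * l) * 2 ^ Q := Nat.mul_le_mul_right _ (by omega)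
          have h3 : (3 * l) * 2 ^ Q = 3 * (l * 2 ^ Q) := by ring
          omega
      refine ⟨hq', hshort, s a.1, ?_, ?_, ?_⟩
      · simp only [hsp]
        exact hadj.symm
      · refine hγ.ne_of_unique hpj.le hjq' hq'N.le hsij.symm fun y hy1 hy2 hsy => ?_
        exact huniq y (by omega) (by omega) (by omega) hsy
      · intro y z hy1 hy2 hyN hz1 hz2 hzN hsy hsz
        rw [huniq y hy1 hy2 hyN hsy, huniq z hz1 hz2 hzN hsz]
  · right
    push Not at hq
    have hbig : (a.2 - a.1) + (a.2 - a.1) * 2 ^ Q ≤ 2 ^ (k + Q + 2) := by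
      have h1 : (a.2 - a.1) * 1 ≤ (a.2 - a.1) * 2 ^ Q := Nat.mul_le_mul_left _ Nat.one_le_two_pow
      have h2 : (a.2 - a.1) * 2 ^ Q ≤ 2 ^ (k + 1) * 2 ^ Q := Nat.mul_le_mul_right _ hk2.le
      have h3 : 2 ^ (k + Q + 2) = 2 * (2 ^ (k + 1) * 2 ^ Q) := by ring
      omega
    obtain ⟨y, hy1, hy2, hyN, hsy, hyp⟩ : ∃ y, a.1 - (a.2 - a.1) * 2 ^ Q ≤ y ∧
        y < a.2 + (a.2 - a.1) * 2 ^ Q + 1 ∧ y < N ∧ s y = u ∧ y ≠ p := by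
      by_contra! hc
      refine hnl ⟨u, hadj, hu, fun y z hy1 hy2 hyN hz1 hz2 hzN hsy hsz => ?_⟩
      rw [hc y hy1 hy2 hyN hsy, hc z hz1 hz2 hzN hsz]
    have hpy : y < p := by
      by_contra hc
      have := hq y (by omega) hyN hsy
      omega
    obtain ⟨p', hp'y, hp'⟩ := exists_isArc_left (by omega : p < N) hpy (hsy.trans hsp.symm)
    have hsp' : s p' = u := hp'.2.2.1.trans hsp
    refine ⟨(p', p), ?_, rfl⟩
    by_cases hlong : 2 ^ k < (p - p') * 2 ^ (Q + 2)
    · exact Or.inl ⟨hp', hlong, by simp only; omega⟩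
    · refine Or.inr ⟨hp', not_lt.1 hlong, fun h hh hN hsh => ?_⟩
      have h1 := hq h hh hN (hsh.trans hsp')
      have h2 : 2 ^ (k + 1) ≤ 2 ^ (k + Q + 2) := Nat.pow_le_pow_right (by norm_num) (by omega)
      simp only at hh ⊢
      omega

open scoped Classical in
/-- The good arcs whose length lies between `2 ^ k` and `2 ^ (k + 1)`. -/
noncomputable def goodArcsAt (G : SimpleGraph V) (N : ℕ) (s : ℕ → V) (γ : ℕ → Config V)
    (Q k : ℕ) : Finset (ℕ × ℕ) :=
  (goodArcs G N s γ Q).filter fun a => Nat.log 2 (a.2 - a.1) = k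

theorem mem_goodArcsAt {G : SimpleGraph V} {N : ℕ} {s : ℕ → V} {γ : ℕ → Config V} {Q k : ℕ}
    {a : ℕ × ℕ} (h : a ∈ goodArcsAt G N s γ Q k) : a ∈ goodArcs G N s γ Q ∧
      2 ^ k ≤ a.2 - a.1 ∧ a.2 - a.1 < 2 ^ (k + 1) := by
  rw [goodArcsAt, Finset.mem_filter] at h
  obtain ⟨h, rfl⟩ := h
  have := (mem_goodArcs h).1.1
  exact ⟨h, Nat.pow_log_le_self 2 (by omega), Nat.lt_pow_succ_log_self (by norm_num) _⟩

/-- There is a scale at which few moves have to be recorded in comparison with the number of good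
arcs. -/
theorem exists_scale [Fintype V] {G : SimpleGraph V} {N : ℕ} {s : ℕ → V} {γ : ℕ → Config V}
    {m : ℕ} (hm : 0 < m) (hN0 : 0 < N) (hN : N = 2 * Fintype.card V) (hT : N ≤ 2 ^ m ^ 2)
    (hrep : ∀ a b, 72 * m * (repeated N s a b).card ≤ (Finset.Ico a (min b N)).card)
    (hlight : ∀ a b, 72 * m * (lightArcs G N s γ a b).card ≤ (Finset.Ico a (min b N)).card) :
    ∃ k, (forwardMoves G N s γ (m + 1) k).card + (backwardMoves G N s γ (m + 1) k).card <
      165 * m * (goodArcsAt G N s γ (m + 1) k).card := by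
  classical
  have hgood := le_card_goodArcs hm hN hT hrep hlight
  have hfib : (goodArcs G N s γ (m + 1)).card =
      ∑ k ∈ Finset.range (m ^ 2), (goodArcsAt G N s γ (m + 1) k).card := by
    rw [Finset.card_eq_sum_card_fiberwise (f := fun a => Nat.log 2 (a.2 - a.1))
      (t := Finset.range (m ^ 2))]
    · refine Finset.sum_congr rfl fun k _ => ?_
      rw [goodArcsAt]
    · intro a ha
      have h := (mem_goodArcs ha).1
      have h1 := h.1
      have h2 := h.2.1
      simp only [Finset.coe_range, Set.mem_Iio]
      exact log_two_lt hT (by omega) (by omega)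
  have hlong := sum_card_longArcs_le N s (m + 1) (m ^ 2)
  -- Over `m ^ 2` scales the long arcs contribute at most `4 * N * (2 * (m + 1) + 6) ≤ 40 * m * N`,
  -- and the rare classes `m ^ 2 * 8 * N / (72 * m) ≤ m * N`. The `N / 4` good arcs turn 41 into
  -- 164; 165 makes the inequality strict.
  have hsum : 72 * m * ∑ k ∈ Finset.range (m ^ 2),
      ((forwardMoves G N s γ (m + 1) k).card + (backwardMoves G N s γ (m + 1) k).card) ≤
      72 * m * (41 * m * N) := by
    calc _ ≤ ∑ k ∈ Finset.range (m ^ 2),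
          (72 * m * (4 * (longArcs N s (m + 1) k).card) + 8 * N) := by
          rw [Finset.mul_sum]
          exact Finset.sum_le_sum fun k _ => card_recordedMoves_le (m + 1) k hrep hlight
      _ = 72 * m * 4 * ∑ k ∈ Finset.range (m ^ 2), (longArcs N s (m + 1) k).card +
          m ^ 2 * (8 * N) := by
          rw [Finset.sum_add_distrib, Finset.mul_sum]
          simp [mul_assoc]
      _ ≤ 72 * m * 4 * (N * (2 * (m + 1) + 6)) + m ^ 2 * (8 * N) := by gcongr
      _ ≤ 72 * m * 4 * (N * (10 * m)) + m ^ 2 * (72 * N) := by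
          gcongr
          · omega
          · norm_num
      _ = 72 * m * (41 * m * N) := by ring
  have hsum' := Nat.le_of_mul_le_mul_left hsum (by positivity)
  obtain ⟨k, -, hk⟩ : ∃ k ∈ Finset.range (m ^ 2),
      (forwardMoves G N s γ (m + 1) k).card + (backwardMoves G N s γ (m + 1) k).card <
        165 * m * (goodArcsAt G N s γ (m + 1) k).card := by
    refine Finset.exists_lt_of_sum_lt ?_
    rw [← Finset.mul_sum, ← hfib]
    calc _ ≤ 41 * m * N := hsum'
      _ ≤ 41 * m * (4 * (goodArcs G N s γ (m + 1)).card) := by gcongr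
      _ = 164 * m * (goodArcs G N s γ (m + 1)).card := by ring
      _ < 165 * m * (goodArcs G N s γ (m + 1)).card := by
          refine Nat.mul_lt_mul_of_pos_right ?_ (by omega)
          omega
  exact ⟨k, hk⟩

/-- Every trajectory of length `2 |V|` in which no node returns to the same neighbourhood has a
certificate in which the number of recorded moves is small in comparison with the number of
arcs. -/
theorem hasCertificate [Fintype V] {G : SimpleGraph V} {N : ℕ} {s : ℕ → V} {γ : ℕ → Config V}
    {m : ℕ} (hm : 0 < m) (hN0 : 0 < N) (hN : N = 2 * Fintype.card V) (hT : N ≤ 2 ^ m ^ 2)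
    (hγ : IsTrajectory N s γ)
    (hval : ∀ i j, IsArc N s i j → ∃ u, G.Adj (s i) u ∧ γ i u ≠ γ j u) :
    HasCertificate G N s γ (2640 * m) := by
  classical
  by_contra hno
  have hno' : ¬ HasCertificate G N s γ (8 * (72 * m)) := fun h => hno (h.mono (by omega))
  have hrep := card_repeated_le hγ hval hno'
  have hlight := card_lightArcs_le hγ hno'
  obtain ⟨k, hk⟩ := exists_scale hm hN0 hN hT hrep hlight
  have : Nonempty V := ⟨s 0⟩
  have hex : ∀ a : ℕ × ℕ, IsArc N s a.1 a.2 → ∃ u, G.Adj (s a.1) u ∧ γ a.1 u ≠ γ a.2 u :=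
    fun a => hval a.1 a.2
  choose! w hw using hex
  set D := goodArcsAt G N s γ (m + 1) k
  set L := forwardMoves G N s γ (m + 1) k
  set R := backwardMoves G N s γ (m + 1) k
  have hnear : ∀ S : Finset ℕ, ∑ t ∈ Finset.range N,
      (S.filter fun q => t < q + 2 ^ (k + 1) ∧ q < t + 2 ^ (k + 1)).card ≤
        2 ^ (k + 2) * S.card := by
    intro S
    have e := Finset.sum_card_bipartiteAbove_eq_sum_card_bipartiteBelow
      (s := Finset.range N) (t := S) (fun t q => t < q + 2 ^ (k + 1) ∧ q < t + 2 ^ (k + 1))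
    simp only [Finset.bipartiteAbove, Finset.bipartiteBelow] at e
    rw [e, mul_comm, ← smul_eq_mul, ← Finset.sum_const]
    refine Finset.sum_le_sum fun q _ => ?_
    have hsub : ((Finset.range N).filter fun t => t < q + 2 ^ (k + 1) ∧ q < t + 2 ^ (k + 1)) ⊆
        Finset.Ico (q + 1 - 2 ^ (k + 1)) (q + 2 ^ (k + 1)) := by
      intro t ht
      simp only [Finset.mem_filter] at ht
      simp only [Finset.mem_Ico]
      omega
    have := Finset.card_le_card hsub
    rw [Nat.card_Ico] at this
    have h2 : 2 ^ (k + 2) = 2 * 2 ^ (k + 1) := by ring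
    omega
  have hcross : 2 ^ k * D.card ≤
      ∑ t ∈ Finset.range N, (D.filter fun a => a.1 < t ∧ t ≤ a.2).card := by
    have e := Finset.sum_card_bipartiteAbove_eq_sum_card_bipartiteBelow
      (s := Finset.range N) (t := D) (fun t a => a.1 < t ∧ t ≤ a.2)
    simp only [Finset.bipartiteAbove, Finset.bipartiteBelow] at e
    rw [e, mul_comm, ← smul_eq_mul, ← Finset.sum_const]
    refine Finset.sum_le_sum fun a ha => ?_
    obtain ⟨h1, h2, -⟩ := mem_goodArcsAt ha
    have h3 := (mem_goodArcs h1).1.2.1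
    have hsub : Finset.Ioc a.1 a.2 ⊆ (Finset.range N).filter fun t => a.1 < t ∧ t ≤ a.2 := by
      intro t ht
      simp only [Finset.mem_Ioc] at ht
      simp only [Finset.mem_filter, Finset.mem_range]
      omega
    have := Finset.card_le_card hsub
    rw [Nat.card_Ioc] at this
    omega
  -- Arcs crossing a common time have distinct nodes, so they do not clash. A move is close to at
  -- most `2 ^ (k + 2)` times while an arc of `D` crosses at least `2 ^ k`, so a suitable `t` costs
  -- only a factor 4.
  obtain ⟨t, -, ht⟩ : ∃ t ∈ Finset.range N,
      (L.filter fun q => t < q + 2 ^ (k + 1) ∧ q < t + 2 ^ (k + 1)).card +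
        (R.filter fun q => t < q + 2 ^ (k + 1) ∧ q < t + 2 ^ (k + 1)).card <
      660 * m * (D.filter fun a => a.1 < t ∧ t ≤ a.2).card := by
    refine Finset.exists_lt_of_sum_lt ?_
    rw [Finset.sum_add_distrib, ← Finset.mul_sum]
    calc _ ≤ 2 ^ (k + 2) * L.card + 2 ^ (k + 2) * R.card := add_le_add (hnear L) (hnear R)
      _ = 2 ^ (k + 2) * (L.card + R.card) := by ring
      _ < 2 ^ (k + 2) * (165 * m * D.card) := Nat.mul_lt_mul_of_pos_left hk (by positivity)
      _ = 660 * m * (2 ^ k * D.card) := by ring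
      _ ≤ _ := Nat.mul_le_mul_left _ hcross
  refine hno ?_
  have hcert : HasCertificate G N s γ (4 * (660 * m)) := by
    refine HasCertificate.of_family _ w _ _ ?_ ?_ ht ?_ ?_ ?_
    · exact fun q hq => forwardMoves_lt (Finset.mem_filter.1 hq).1
    · exact fun q hq => backwardMoves_lt (Finset.mem_filter.1 hq).1
    · intro a ha
      have h := (mem_goodArcs (mem_goodArcsAt (Finset.mem_filter.1 ha).1).1).1
      exact ⟨h, hw a h⟩
    · intro a ha b hb hab hs
      obtain ⟨ha, ha1, ha2⟩ := Finset.mem_filter.1 ha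
      obtain ⟨hb, hb1, hb2⟩ := Finset.mem_filter.1 hb
      have h1 := (mem_goodArcs (mem_goodArcsAt ha).1).1
      have h2 := (mem_goodArcs (mem_goodArcsAt hb).1).1
      by_cases hne : a.1 = b.1
      · refine absurd (Prod.ext hne (h1.right_unique ?_)) hab
        rw [hne]
        exact h2
      · rcases h1.le_or_le h2 hs hne with h | h <;> omega
    · intro a ha u hadj hu
      obtain ⟨ha, ha1, ha2⟩ := Finset.mem_filter.1 ha
      obtain ⟨hg, hk1, hk2⟩ := mem_goodArcsAt ha
      obtain ⟨q, hq, h1, h2, h3, h4⟩ := exists_mem_forwardMoves hγ hg hk1 hk2 hadj hu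
      obtain ⟨p, hp, g1, g2, g3, g4⟩ := exists_mem_backwardMoves hγ hg hk1 hk2 hadj hu
      exact ⟨⟨q, Finset.mem_filter.2 ⟨hq, by omega, by omega⟩, h1, h2, h4⟩,
        ⟨p, Finset.mem_filter.2 ⟨hp, by omega, by omega⟩, g1, g3, g4⟩⟩
  exact hcert.mono (by omega)

end Combinatorial

/-! ### Linear forms of arcs, and their reconstruction from claims -/

section Energy

variable {V : Type u}

/-- The product of the signs of the endpoints of an edge. -/
def edgeSign (γ : Config V) : Sym2 V → ℤˣ :=
  Sym2.lift ⟨fun a b => γ a * γ b, fun _ _ => mul_comm _ _⟩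

@[simp]
theorem edgeSign_mk (γ : Config V) (a b : V) : edgeSign γ s(a, b) = γ a * γ b := rfl

theorem units_mul_eq_neg_one_iff (a b : ℤˣ) : a * b = -1 ↔ a ≠ b := by
  rcases Int.units_eq_one_or a with rfl | rfl <;> rcases Int.units_eq_one_or b with rfl | rfl <;>
    decide

theorem exists_ne_iff_edgeSign (γ : Config V) (e : Sym2 V) :
    (∃ u ∈ e, ∃ v ∈ e, γ u ≠ γ v) ↔ edgeSign γ e = -1 := by
  induction e with
  | h a b =>
    rw [edgeSign_mk, units_mul_eq_neg_one_iff]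
    simp only [Sym2.mem_iff]
    constructor
    · rintro ⟨u, rfl | rfl, v, rfl | rfl, h⟩
      exacts [absurd rfl h, h, h.symm, absurd rfl h]
    · exact fun h => ⟨a, Or.inl rfl, b, Or.inr rfl, h⟩

theorem edgeSign_flip_of_mem (γ : Config V) {v : V} {e : Sym2 V} (he : ¬ e.IsDiag) (hv : v ∈ e) :
    edgeSign (flip γ v) e = -edgeSign γ e := by
  rw [← Sym2.other_spec hv, edgeSign_mk, edgeSign_mk, flip_apply_self,
    flip_apply_of_ne _ (Sym2.other_ne he hv), neg_mul]

theorem edgeSign_flip_of_notMem (γ : Config V) {v : V} {e : Sym2 V} (hv : v ∉ e) :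
    edgeSign (flip γ v) e = edgeSign γ e := by
  induction e with
  | h a b =>
    rw [Sym2.mem_iff, not_or] at hv
    rw [edgeSign_mk, edgeSign_mk, flip_apply_of_ne _ (Ne.symm hv.1),
      flip_apply_of_ne _ (Ne.symm hv.2)]

open scoped Classical in
/-- The coefficient of the weight of the edge `e` in the change of the cut weight caused by
flipping `v`. -/
noncomputable def change (γ : Config V) (v : V) (e : Sym2 V) : ℝ :=
  if v ∈ e then (((edgeSign γ e : ℤˣ) : ℤ) : ℝ) else 0

theorem change_mk (γ : Config V) (v u : V) :
    change γ v s(v, u) = ((γ v : ℤ) : ℝ) * ((γ u : ℤ) : ℝ) := by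
  simp [change]

variable {G : SimpleGraph V}

open scoped Classical in
theorem cutWeight_flip_sub [Fintype V] (X : G.edgeSet → ℝ) (γ : Config V) (v : V) :
    cutWeight G X (flip γ v) - cutWeight G X γ = ∑ e : G.edgeSet, change γ v e.1 * X e := by
  simp only [cutWeight, exists_ne_iff_edgeSign]
  rw [← Finset.sum_sub_distrib]
  refine Finset.sum_congr rfl fun e _ => ?_
  by_cases hv : v ∈ e.1
  · rw [edgeSign_flip_of_mem γ (G.not_isDiag_of_mem_edgeSet e.2) hv, change, if_pos hv]
    rcases Int.units_eq_one_or (edgeSign γ e.1) with h | h <;> rw [h] <;> norm_num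
  · rw [edgeSign_flip_of_notMem γ hv, change, if_neg hv]
    simp

/-- `c = (u, x, y, σ)` states that the node `u` has sign `σ` from time `x` to time `y`. -/
abbrev Claim (V : Type u) (N : ℕ) : Type u := V × Fin (N + 1) × Fin (N + 1) × ℤˣ

/-- Some claim in `C` concerns the node `u` at time `i`. -/
def Covers {N : ℕ} (C : Finset (Claim V N)) (u : V) (i : ℕ) : Prop :=
  ∃ c ∈ C, c.1 = u ∧ (c.2.1 : ℕ) ≤ i ∧ i ≤ (c.2.2.1 : ℕ)

open scoped Classical in
/-- The sign of `u` at time `i` according to the claims in `C`, or `0` if there is no such claim. -/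
noncomputable def claimedSign {N : ℕ} (C : Finset (Claim V N)) (u : V) (i : ℕ) : ℝ :=
  if h : Covers C u i then (((Classical.choose h).2.2.2 : ℤ) : ℝ) else 0

open scoped Classical in
/-- The vector of coefficients of the total change of the cut weight caused by two moves of the
node `c.1` at the times `c.2.1` and `c.2.2.1`, as reconstructed from the claims in `C`. -/
noncomputable def claimedChange {N : ℕ} (C : Finset (Claim V N)) (c : Claim V N) (e : Sym2 V) : ℝ :=
  if h : c.1 ∈ e then
    ((c.2.2.2 : ℤ) : ℝ) *
      (if claimedSign C (Sym2.Mem.other h) c.2.1 ≠ 0 ∧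
          claimedSign C (Sym2.Mem.other h) c.2.2.1 ≠ 0 then
        claimedSign C (Sym2.Mem.other h) c.2.1 - claimedSign C (Sym2.Mem.other h) c.2.2.1 else 0)
  else 0

/-- All claims in `C` are true for `γ`. -/
def ClaimsTrue {N : ℕ} (γ : ℕ → Config V) (C : Finset (Claim V N)) : Prop :=
  ∀ c ∈ C, ∀ z, (c.2.1 : ℕ) ≤ z → z ≤ (c.2.2.1 : ℕ) → γ z c.1 = c.2.2.2

theorem claimedSign_of_covers {N : ℕ} {γ : ℕ → Config V} {C : Finset (Claim V N)}
    (hC : ClaimsTrue γ C) {u : V} {i : ℕ} (h : Covers C u i) :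
    claimedSign C u i = ((γ i u : ℤ) : ℝ) := by
  rw [claimedSign, dif_pos h]
  obtain ⟨h1, h2, h3, h4⟩ := Classical.choose_spec h
  rw [← hC _ h1 i h3 h4, h2]

theorem claimedSign_of_not_covers {N : ℕ} {C : Finset (Claim V N)} {u : V} {i : ℕ}
    (h : ¬ Covers C u i) : claimedSign C u i = 0 := by
  rw [claimedSign, dif_neg h]

theorem units_cast_ne_zero (a : ℤˣ) : ((a : ℤ) : ℝ) ≠ 0 := by
  simp

/-- Since the sign of `v` is reversed between the times `i` and `j`, the coefficient of `vu` is `γ i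
v * (γ i u - γ j u)`. For an unchanged neighbour this is 0, which is also the reconstructed value
whether or not both signs are known; so only changed neighbours need claims. -/
theorem claimedChange_eq {N : ℕ} {γ : ℕ → Config V} {C : Finset (Claim V N)}
    (hC : ClaimsTrue γ C) {v : V} {c : Claim V N} (hv : c.1 = v)
    (hσ : c.2.2.2 = γ c.2.1 v) (hneg : γ c.2.2.1 v = -γ c.2.1 v)
    (hcov : ∀ u, G.Adj v u → γ c.2.1 u ≠ γ c.2.2.1 u → Covers C u c.2.1 ∧ Covers C u c.2.2.1)
    (e : G.edgeSet) :
    claimedChange C c e.1 = change (γ c.2.1) v e.1 + change (γ c.2.2.1) v e.1 := by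
  by_cases hve : v ∈ e.1
  · have hce : c.1 ∈ e.1 := hv ▸ hve
    obtain ⟨u, hu⟩ : ∃ u, u = Sym2.Mem.other hce := ⟨_, rfl⟩
    have hspec : s(v, u) = e.1 := by
      rw [hu, ← hv]
      exact Sym2.other_spec hce
    have hadj : G.Adj v u := by
      rw [← SimpleGraph.mem_edgeSet, hspec]
      exact e.2
    rw [← hspec, change_mk, change_mk, hneg, hspec, claimedChange, dif_pos hce, ← hu, hσ]
    by_cases hne : γ c.2.1 u = γ c.2.2.1 u
    · have hz : (if claimedSign C u c.2.1 ≠ 0 ∧ claimedSign C u c.2.2.1 ≠ 0 then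
          claimedSign C u c.2.1 - claimedSign C u c.2.2.1 else 0) = 0 := by
        by_cases h1 : Covers C u c.2.1
        · by_cases h2 : Covers C u c.2.2.1
          · rw [claimedSign_of_covers hC h1, claimedSign_of_covers hC h2, hne]
            simp
          · rw [claimedSign_of_not_covers h2]
            simp
        · rw [claimedSign_of_not_covers h1]
          simp
      rw [hz, hne]
      push_cast
      ring
    · obtain ⟨h1, h2⟩ := hcov u hadj hne
      rw [claimedSign_of_covers hC h1, claimedSign_of_covers hC h2,
        if_pos ⟨units_cast_ne_zero _, units_cast_ne_zero _⟩]
      push_cast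
      ring
  · have hce : c.1 ∉ e.1 := hv ▸ hve
    rw [claimedChange, dif_neg hce, change, change, if_neg hve, if_neg hve, add_zero]

variable (G) in
/-- For every `c ∈ A` there is an edge that occurs in the reconstructed change vector of `c`, but in
none of the other reconstructed change vectors. -/
def IsDiagonal {N : ℕ} (A C : Finset (Claim V N)) : Prop :=
  ∀ c ∈ A, ∃ e : G.edgeSet, 1 ≤ |claimedChange C c e.1| ∧
    ∀ c' ∈ A, c' ≠ c → claimedChange C c' e.1 = 0

/-- The interval is the maximal one before the move `q`, so a single claim serves every time at
which `q` is the next move of its node. It may include `q`, because `γ q` is the configuration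
before that move. -/
theorem exists_forward_claim {N : ℕ} {s : ℕ → V} {γ : ℕ → Config V} (hγ : IsTrajectory N s γ)
    {q : ℕ} (hq : q < N) : ∃ c : Claim V N, c.1 = s q ∧
      (∀ z, (c.2.1 : ℕ) ≤ z → z ≤ (c.2.2.1 : ℕ) → γ z c.1 = c.2.2.2) ∧
      ∀ i ≤ q, (∀ z, i ≤ z → z < q → s z ≠ s q) → (c.2.1 : ℕ) ≤ i ∧ i ≤ (c.2.2.1 : ℕ) := by
  obtain ⟨x, -, hxq, hx, hmin⟩ := exists_first_ge (P := fun x => ∀ z, x ≤ z → z < q → s z ≠ s q)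
    (Nat.zero_le q) (fun z h1 h2 => by omega)
  refine ⟨(s q, ⟨x, by omega⟩, ⟨q, by omega⟩, γ q (s q)), rfl, fun z h1 h2 => ?_,
    fun i hi h => ⟨?_, hi⟩⟩
  · exact (hγ.eq_of_forall_ne h2 hq.le fun t h3 h4 => hx t (le_trans h1 h3) h4).symm
  · by_contra hc
    exact hmin i (Nat.zero_le _) (not_le.1 hc) h

theorem exists_backward_claim {N : ℕ} {s : ℕ → V} {γ : ℕ → Config V} (hγ : IsTrajectory N s γ)
    {p : ℕ} (hp : p < N) : ∃ c : Claim V N, c.1 = s p ∧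
      (∀ z, (c.2.1 : ℕ) ≤ z → z ≤ (c.2.2.1 : ℕ) → γ z c.1 = c.2.2.2) ∧
      ∀ j ≤ N, p < j → (∀ z, p < z → z < j → s z ≠ s p) →
        (c.2.1 : ℕ) ≤ j ∧ j ≤ (c.2.2.1 : ℕ) := by
  obtain ⟨y, hyN, hy, hmax⟩ := exists_last_lt
    (P := fun y => p < y ∧ ∀ z, p < z → z < y → s z ≠ s p) (j := N + 1)
    ⟨p + 1, by omega, by omega, fun z h1 h2 => by omega⟩
  refine ⟨(s p, ⟨p + 1, by omega⟩, ⟨y, by omega⟩, γ (p + 1) (s p)), rfl, fun z h1 h2 => ?_,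
    fun j hj hpj h => ⟨hpj, ?_⟩⟩
  · exact hγ.eq_of_forall_ne h1 (le_trans h2 (Nat.lt_succ_iff.1 hyN))
      fun t h3 h4 => hy.2 t h3 (lt_of_lt_of_le h4 h2)
  · by_contra hc
    exact hmax j (not_le.1 hc) (by omega) ⟨hpj, h⟩

/-- Each recorded move becomes a claim and each arc a member of `A`. The reconstructed forms depend
on the pair `(A, C)` alone, not on the trajectory or the weights, which permits a union bound. -/
theorem HasCertificate.exists_claims {N : ℕ} {s : ℕ → V} {γ : ℕ → Config V} {K : ℕ}
    (hγ : IsTrajectory N s γ) (h : HasCertificate G N s γ K) :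
    ∃ A C : Finset (Claim V N), A.Nonempty ∧ C.card ≤ K * A.card ∧ IsDiagonal G A C ∧
      ∀ c ∈ A, ∃ i j, IsArc N s i j ∧
        ∀ e : G.edgeSet, claimedChange C c e.1 =
          change (γ i) (s i) e.1 + change (γ j) (s j) e.1 := by
  classical
  obtain ⟨A, w, L, R, hne, hL, hR, hcard, hA, hdiag, hcov⟩ := h
  have hLc : ∀ q ∈ L, _ := fun q hq => exists_forward_claim hγ (hL q hq)
  have hRc : ∀ p ∈ R, _ := fun p hp => exists_backward_claim hγ (hR p hp)
  have : Nonempty (Claim V N) := ⟨(s 0, 0, 0, 1)⟩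
  choose! f hf1 hf2 hf3 using hLc
  choose! g hg1 hg2 hg3 using hRc
  have hAc : ∀ a ∈ A, ∃ c : Claim V N, c.1 = s a.1 ∧ (c.2.1 : ℕ) = a.1 ∧ (c.2.2.1 : ℕ) = a.2 ∧
      c.2.2.2 = γ a.1 (s a.1) := by
    intro a ha
    obtain ⟨h1, h2, -⟩ := (hA a ha).1
    exact ⟨(s a.1, ⟨a.1, by omega⟩, ⟨a.2, by omega⟩, γ a.1 (s a.1)), rfl, rfl, rfl, rfl⟩
  choose! k hk1 hk2 hk3 hk4 using hAc
  set C := L.image f ∪ R.image g with hCdef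
  have hC : ClaimsTrue γ C := by
    intro c hc
    rcases Finset.mem_union.1 hc with hc | hc
    · obtain ⟨q, hq, rfl⟩ := Finset.mem_image.1 hc
      exact hf2 q hq
    · obtain ⟨p, hp, rfl⟩ := Finset.mem_image.1 hc
      exact hg2 p hp
  have hinj : Set.InjOn k A := by
    intro a ha b hb hab
    refine Prod.ext ?_ ?_
    · rw [← hk2 a ha, ← hk2 b hb, hab]
    · rw [← hk3 a ha, ← hk3 b hb, hab]
  have heq : ∀ a ∈ A, ∀ e : G.edgeSet, claimedChange C (k a) e.1 =
      change (γ a.1) (s a.1) e.1 + change (γ a.2) (s a.1) e.1 := by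
    intro a ha e
    obtain ⟨harc, hadj, hch⟩ := hA a ha
    rw [← hk2 a ha, ← hk3 a ha, hk2 a ha]
    have := claimedChange_eq (G := G) hC (hk1 a ha) (by rw [hk4 a ha, hk2 a ha])
      (by rw [hk2 a ha, hk3 a ha]; exact harc.eq_neg hγ) ?_ e
    · rw [this, hk2 a ha]
    · intro u hu hne
      rw [hk2 a ha, hk3 a ha] at hne ⊢
      obtain ⟨⟨q, hq, hsq, hiq, hmin⟩, p, hp, hsp, hpj, hmax⟩ := hcov a ha u hu hne
      subst hsq
      refine ⟨⟨f q, ?_, hf1 q hq, hf3 q hq a.1 hiq hmin⟩,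
        ⟨g p, ?_, (hg1 p hp).trans hsp, hg3 p hp a.2 harc.2.1.le hpj ?_⟩⟩
      · exact Finset.mem_union_left _ (Finset.mem_image_of_mem _ hq)
      · exact Finset.mem_union_right _ (Finset.mem_image_of_mem _ hp)
      · rw [hsp]
        exact hmax
  refine ⟨A.image k, C, hne.image _, ?_, ?_, ?_⟩
  · rw [Finset.card_image_of_injOn hinj]
    exact (Finset.card_union_le _ _).trans
      ((add_le_add Finset.card_image_le Finset.card_image_le).trans hcard)
  · intro c hc
    obtain ⟨a, ha, rfl⟩ := Finset.mem_image.1 hc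
    obtain ⟨harc, hadj, hch⟩ := hA a ha
    refine ⟨⟨s(s a.1, w a), hadj⟩, ?_, ?_⟩
    · rw [heq a ha, change_mk, change_mk, harc.eq_neg hγ]
      rcases Int.units_eq_one_or (γ a.1 (s a.1)) with h1 | h1 <;>
      rcases Int.units_eq_one_or (γ a.1 (w a)) with h2 | h2 <;>
      rcases Int.units_eq_one_or (γ a.2 (w a)) with h3 | h3 <;>
      first
      | (exact absurd (h2.trans h3.symm) hch)
      | (rw [h1, h2, h3]; norm_num)
    · intro c' hc' hne'
      obtain ⟨b, hb, rfl⟩ := Finset.mem_image.1 hc'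
      have hab : a ≠ b := fun h => hne' (by rw [h])
      obtain ⟨hd1, hd2⟩ := hdiag a ha b hb hab
      rw [heq b hb]
      by_cases hs : s b.1 = s a.1
      · have h3 := (hA b hb).1.eq_neg hγ
        rw [hs] at h3 ⊢
        simp only [change_mk]
        rw [h3, hd2 hs]
        push_cast
        ring
      · have hnot : s b.1 ∉ s(s a.1, w a) := by
          rw [Sym2.mem_iff, not_or]
          exact ⟨hs, hd1⟩
        simp [change, hs, hd1]
  · intro c hc
    obtain ⟨a, ha, rfl⟩ := Finset.mem_image.1 hc
    have harc := (hA a ha).1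
    refine ⟨a.1, a.2, harc, fun e => ?_⟩
    rw [heq a ha, harc.2.2.1]

end Energy

/-! ### Small-ball estimates for diagonal systems of linear forms -/

section Probability

theorem IsSmoothedLaw.nonneg {μ : Measure ℝ} {φ : ℝ} (h : IsSmoothedLaw μ φ) : 0 ≤ φ := by
  obtain ⟨f, -, h0, h1, -⟩ := h.bounded_density
  exact (h0 0).trans (h1 0)

theorem IsSmoothedLaw.measure_le {μ : Measure ℝ} {φ : ℝ} (h : IsSmoothedLaw μ φ) (s : Set ℝ) :
    μ s ≤ ENNReal.ofReal φ * volume s := by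
  obtain ⟨f, -, -, h1, rfl⟩ := h.bounded_density
  calc (volume.withDensity fun x => ENNReal.ofReal (f x)) s
      ≤ (volume.withDensity fun _ => ENNReal.ofReal φ) s :=
        withDensity_mono (ae_of_all _ fun x => ENNReal.ofReal_le_ofReal (h1 x)) s
    _ = _ := by rw [withDensity_const, Measure.smul_apply, smul_eq_mul]

/-- Mass 1 on an interval of length 2 needs density at least `1 / 2` somewhere. This later absorbs a
term without the factor `φ` into the bound on path lengths. -/
theorem IsSmoothedLaw.half_le {μ : Measure ℝ} {φ : ℝ} (h : IsSmoothedLaw μ φ) : 1 / 2 ≤ φ := by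
  have := h.isProbabilityMeasure
  have h1 : μ (Set.Icc (-1) 1) = 1 := (prob_compl_eq_zero_iff measurableSet_Icc).1 h.supported
  have h2 := h.measure_le (Set.Icc (-1) 1)
  rw [h1, Real.volume_Icc, ← ENNReal.ofReal_mul h.nonneg, ← ENNReal.ofReal_one] at h2
  have := (ENNReal.ofReal_le_ofReal_iff (by have := h.nonneg; linarith)).1 h2
  linarith

theorem IsSmoothedLaw.measure_abs_le {μ : Measure ℝ} {φ : ℝ} (h : IsSmoothedLaw μ φ)
    {a : ℝ} (ha : 1 ≤ |a|) (r ε : ℝ) :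
    μ {x | |r + a * x| ≤ ε} ≤ ENNReal.ofReal (2 * ε * φ) := by
  have hsub : {x | |r + a * x| ≤ ε} ⊆ Metric.closedBall (-r / a) ε := by
    intro x hx
    have ha0 : a ≠ 0 := by
      rintro rfl
      norm_num at ha
    have hx' : |r + a * x| ≤ ε := hx
    rw [Metric.mem_closedBall, Real.dist_eq]
    have e : r + a * x = a * (x - -r / a) := by
      field_simp
      ring
    rw [e, abs_mul] at hx'
    have := abs_nonneg (x - -r / a)
    nlinarith
  calc μ {x | |r + a * x| ≤ ε} ≤ μ (Metric.closedBall (-r / a) ε) := measure_mono hsub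
    _ ≤ ENNReal.ofReal φ * volume (Metric.closedBall (-r / a) ε) := h.measure_le _
    _ = ENNReal.ofReal (2 * ε * φ) := by
      rw [Real.volume_closedBall, ← ENNReal.ofReal_mul h.nonneg]
      congr 1
      ring

variable {E : Type*} [Fintype E]

/-- If `S` does not depend on the coordinate `c`, and every section of `T` in the direction of
this coordinate has measure at most `κ`, then the measure of `S ∩ T` is at most `κ` times the
measure of `S`. -/
theorem pi_inter_le (μ : E → Measure ℝ) [∀ e, IsProbabilityMeasure (μ e)] {S T : Set (E → ℝ)}
    (hS : MeasurableSet S) (hT : MeasurableSet T) (c : E) {κ : ENNReal}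
    [DecidableEq E]
    (hSc : ∀ X x, Function.update X c x ∈ S ↔ X ∈ S)
    (hTc : ∀ X, μ c {x | Function.update X c x ∈ T} ≤ κ) :
    Measure.pi μ (S ∩ T) ≤ κ * Measure.pi μ S := by
  have hf : Measurable ((S ∩ T).indicator (1 : (E → ℝ) → ENNReal)) :=
    measurable_one.indicator (hS.inter hT)
  have hg : Measurable (fun X => κ * S.indicator (1 : (E → ℝ) → ENNReal) X) :=
    (measurable_one.indicator hS).const_mul κ
  -- Both measures become iterated integrals in which the coordinate `c` is integrated first.
  rw [← lintegral_indicator_one (hS.inter hT), ← lintegral_indicator_one hS,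
    ← lintegral_const_mul κ (measurable_one.indicator hS),
    lintegral_eq_lmarginal_univ (fun _ => 0), lintegral_eq_lmarginal_univ (fun _ => 0),
    lmarginal_erase' _ hf (Finset.mem_univ c), lmarginal_erase' _ hg (Finset.mem_univ c)]
  refine lmarginal_mono (fun X => ?_) _
  by_cases hX : X ∈ S
  · have e1 : ∀ x, (S ∩ T).indicator (1 : (E → ℝ) → ENNReal) (Function.update X c x) =
        {x | Function.update X c x ∈ T}.indicator 1 x := by
      intro x
      by_cases hx : Function.update X c x ∈ T
      · rw [Set.indicator_of_mem (Set.mem_inter ((hSc X x).2 hX) hx),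
          Set.indicator_of_mem (by exact hx)]
        rfl
      · rw [Set.indicator_of_notMem (fun h => hx h.2), Set.indicator_of_notMem (by exact hx)]
    have e2 : ∀ x, S.indicator (1 : (E → ℝ) → ENNReal) (Function.update X c x) = 1 := by
      intro x
      rw [Set.indicator_of_mem ((hSc X x).2 hX)]
      rfl
    simp only [e1, e2]
    have hm : MeasurableSet {x | Function.update X c x ∈ T} := measurable_update X hT
    rw [lintegral_indicator_one hm]
    simpa using hTc X
  · have e1 : ∀ x, (S ∩ T).indicator (1 : (E → ℝ) → ENNReal) (Function.update X c x) = 0 := by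
      intro x
      rw [Set.indicator_of_notMem (fun h => hX ((hSc X x).1 h.1))]
    simp [e1]

/-- A diagonal system of `r` linear forms in independent smoothed variables is uniformly small with
probability at most `(2 ε φ) ^ r`. -/
theorem pi_forall_abs_sum_le {ι : Type*} (μ : E → Measure ℝ) {φ : ℝ}
    (hμ : ∀ e, IsSmoothedLaw (μ e) φ) (A : Finset ι) (a : ι → E → ℝ)
    (hA : ∀ i ∈ A, ∃ e, 1 ≤ |a i e| ∧ ∀ j ∈ A, j ≠ i → a j e = 0) (ε : ℝ) :
    Measure.pi μ {X | ∀ i ∈ A, |∑ e, a i e * X e| ≤ ε} ≤ ENNReal.ofReal (2 * ε * φ) ^ A.card := by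
  classical
  have : ∀ e, IsProbabilityMeasure (μ e) := fun e => (hμ e).isProbabilityMeasure
  have hmeas : ∀ i, MeasurableSet {X : E → ℝ | |∑ e, a i e * X e| ≤ ε} := by
    intro i
    refine measurableSet_le ?_ measurable_const
    fun_prop
  have hupd : ∀ (b : E → ℝ) (c : E) (X : E → ℝ) (x : ℝ),
      ∑ e, b e * Function.update X c x e = ∑ e ∈ Finset.univ.erase c, b e * X e + b c * x := by
    intro b c X x
    rw [← Finset.sum_erase_add _ _ (Finset.mem_univ c), Function.update_self]
    congr 1
    refine Finset.sum_congr rfl fun e he => ?_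
    rw [Function.update_of_ne (Finset.ne_of_mem_erase he)]
  induction A using Finset.induction_on with
  | empty => simp
  | insert i A hi ih =>
    -- The private coordinate `c` of the form `i` does not enter the events of the other forms, and
    -- given all other coordinates the new event has probability at most `2 * ε * φ`.
    obtain ⟨c, hc1, hc2⟩ := hA i (Finset.mem_insert_self _ _)
    have hset : {X : E → ℝ | ∀ j ∈ insert i A, |∑ e, a j e * X e| ≤ ε} =
        {X | ∀ j ∈ A, |∑ e, a j e * X e| ≤ ε} ∩ {X | |∑ e, a i e * X e| ≤ ε} := by
      ext X
      simp only [Finset.mem_insert, forall_eq_or_imp, Set.mem_ofPred_eq, Set.mem_inter_iff]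
      exact and_comm
    have hmA : MeasurableSet {X : E → ℝ | ∀ j ∈ A, |∑ e, a j e * X e| ≤ ε} := by
      have : {X : E → ℝ | ∀ j ∈ A, |∑ e, a j e * X e| ≤ ε} =
          ⋂ j ∈ A, {X : E → ℝ | |∑ e, a j e * X e| ≤ ε} := by
        ext X
        simp
      rw [this]
      exact A.measurableSet_biInter fun j _ => hmeas j
    rw [hset, Finset.card_insert_of_notMem hi, pow_succ']
    refine (pi_inter_le μ hmA (hmeas i) c (κ := ENNReal.ofReal (2 * ε * φ)) ?_ ?_).trans ?_
    · intro X x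
      simp only [Set.mem_ofPred_eq]
      refine forall₂_congr fun j hj => ?_
      have h0 : a j c = 0 := hc2 j (Finset.mem_insert_of_mem hj) (fun h => hi (h ▸ hj))
      rw [hupd, h0, ← Finset.sum_erase_add _ _ (Finset.mem_univ c), h0]
      simp
    · intro X
      simp only [Set.mem_ofPred_eq, hupd]
      exact (hμ c).measure_abs_le hc1 _ _
    · gcongr
      refine ih fun j hj => ?_
      obtain ⟨e, he1, he2⟩ := hA j (Finset.mem_insert_of_mem hj)
      exact ⟨e, he1, fun k hk => he2 k (Finset.mem_insert_of_mem hk)⟩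

end Probability

/-! ### Union bound over arcs and claims -/

section UnionBound

theorem card_filter_card_le {α : Type*} [Fintype α] (k : ℕ) :
    (Finset.univ.filter fun C : Finset α => C.card ≤ k).card ≤ (Fintype.card α + 1) ^ k := by
  classical
  induction k with
  | zero =>
    simp [Finset.filter_eq']
  | succ k ih =>
    have hsub : (Finset.univ.filter fun C : Finset α => C.card ≤ k + 1) ⊆
        (Finset.univ.filter fun C : Finset α => C.card ≤ k) ∪
          Finset.powersetCard (k + 1) Finset.univ := by
      intro C hC
      simp only [Finset.mem_filter, Finset.mem_univ, true_and] at hC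
      simp only [Finset.mem_union, Finset.mem_filter, Finset.mem_univ, true_and,
        Finset.mem_powersetCard, Finset.subset_univ]
      omega
    calc _ ≤ _ := Finset.card_le_card hsub
      _ ≤ _ := Finset.card_union_le _ _
      _ ≤ (Fintype.card α + 1) ^ k + Fintype.card α ^ (k + 1) := by
        rw [Finset.card_powersetCard, Finset.card_univ]
        exact add_le_add ih (Nat.choose_le_pow _ _)
      _ ≤ (Fintype.card α + 1) ^ k + (Fintype.card α + 1) ^ k * Fintype.card α := by
        rw [pow_succ]
        gcongr
        omega
      _ = _ := by ring

/-- With `M` elements in `α`, a given `A` admits at most `(M + 1) ^ (q * |A|)` sets `C`. With `y =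
(M + 1) ^ q * x` the sum is therefore at most that of `y ^ |A|` over nonempty `A`, which is `(1 + y)
^ M - 1 ≤ exp (M * y) - 1`. -/
theorem sum_pow_card_le {α : Type*} [Fintype α] {q : ℕ} {x : ℝ} (hx : 0 ≤ x)
    (hx1 : Fintype.card α * ((Fintype.card α + 1) ^ q * x) ≤ 1)
    (P : Finset (Finset α × Finset α))
    (hP : ∀ p ∈ P, p.1.Nonempty ∧ p.2.card ≤ q * p.1.card) :
    ∑ p ∈ P, x ^ p.1.card ≤ 2 * (Fintype.card α * ((Fintype.card α + 1) ^ q * x)) := by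
  classical
  set M := Fintype.card α
  set y : ℝ := (M + 1) ^ q * x with hy
  have hy0 : 0 ≤ y := by positivity
  have hsub : P ⊆ (Finset.univ.erase (∅ : Finset α)).biUnion fun A =>
      (Finset.univ.filter fun C : Finset α => C.card ≤ q * A.card).image fun C => (A, C) := by
    rintro ⟨A, C⟩ hp
    obtain ⟨h1, h2⟩ := hP _ hp
    simp only [Finset.mem_biUnion, Finset.mem_erase, Finset.mem_univ, and_true, Finset.mem_image,
      Finset.mem_filter, true_and]
    exact ⟨A, h1.ne_empty, C, h2, rfl⟩
  calc ∑ p ∈ P, x ^ p.1.card ≤ _ :=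
        Finset.sum_le_sum_of_subset_of_nonneg hsub fun _ _ _ => by positivity
    _ ≤ ∑ A ∈ Finset.univ.erase (∅ : Finset α), ∑ p ∈
          (Finset.univ.filter fun C : Finset α => C.card ≤ q * A.card).image fun C => (A, C),
          x ^ p.1.card := by
        rw [Finset.sum_biUnion]
        intro A _ B _ hAB
        simp only [Function.onFun, Finset.disjoint_left, Finset.mem_image]
        rintro p ⟨C, -, rfl⟩ ⟨D, -, h⟩
        exact hAB (Prod.ext_iff.1 h).1.symm
    _ ≤ ∑ A ∈ Finset.univ.erase (∅ : Finset α), y ^ A.card := by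
        refine Finset.sum_le_sum fun A _ => ?_
        rw [Finset.sum_image fun C _ D _ h => (Prod.ext_iff.1 h).2]
        simp only [Finset.sum_const, nsmul_eq_mul]
        rw [hy, mul_pow, ← pow_mul]
        gcongr
        have := card_filter_card_le (α := α) (q * A.card)
        exact_mod_cast this
    _ = (y + 1) ^ M - 1 := by
        have h := Finset.sum_pow_mul_eq_add_pow y 1 (Finset.univ : Finset α)
        simp only [one_pow, mul_one, Finset.powerset_univ, Finset.card_univ] at h
        rw [← h, ← Finset.sum_erase_add _ _ (Finset.mem_univ (∅ : Finset α))]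
        simp
    _ ≤ Real.exp (M * y) - 1 := by
        have h1 := Real.add_one_le_exp y
        rw [Real.exp_nat_mul]
        gcongr
    _ ≤ 2 * (M * y) := by
        have h0 : 0 ≤ M * y := by positivity
        have h := Real.abs_exp_sub_one_le (x := M * y) (by rw [abs_of_nonneg h0]; exact hx1)
        rw [abs_of_nonneg h0] at h
        exact (le_abs_self _).trans h

variable {V : Type u} {G : SimpleGraph V}

/-- The weights for which some improving trajectory of length `N` has total improvement at most
`ε`. -/
def badWeights [Fintype V] (G : SimpleGraph V) (N : ℕ) (ε : ℝ) : Set (G.edgeSet → ℝ) :=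
  {X | ∃ (s : ℕ → V) (γ : ℕ → Config V), IsTrajectory N s γ ∧
    (∀ t < N, cutWeight G X (γ t) < cutWeight G X (γ (t + 1))) ∧
    cutWeight G X (γ N) - cutWeight G X (γ 0) ≤ ε}

theorem change_add_change_eq_zero {γ γ' : Config V} {v : V} (hv : γ' v = -γ v)
    (h : ∀ u, G.Adj v u → γ u = γ' u) (e : G.edgeSet) :
    change γ v e.1 + change γ' v e.1 = 0 := by
  by_cases hve : v ∈ e.1
  · have hspec := Sym2.other_spec hve
    have hadj : G.Adj v (Sym2.Mem.other hve) := by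
      rw [← SimpleGraph.mem_edgeSet, hspec]
      exact e.2
    have := h _ hadj
    rw [← hspec, change_mk, change_mk, hv, this]
    push_cast
    ring
  · simp [change, hve]

open scoped Classical in
-- All gains are positive and their sum is at most `ε`, so the two gains of an arc have sum in `(0,
-- ε]`. Positivity also provides a changed neighbour along every arc, since otherwise the form of
-- the arc would vanish.
theorem exists_claims_of_mem_badWeights [Fintype V] {N m : ℕ} {ε : ℝ} (hm : 0 < m) (hN0 : 0 < N)
    (hN : N = 2 * Fintype.card V) (hT : N ≤ 2 ^ m ^ 2) {X : G.edgeSet → ℝ}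
    (hX : X ∈ badWeights G N ε) :
    ∃ A C : Finset (Claim V N), A.Nonempty ∧ C.card ≤ 2640 * m * A.card ∧ IsDiagonal G A C ∧
      ∀ c ∈ A, |∑ e : G.edgeSet, claimedChange C c e.1 * X e| ≤ ε := by
  obtain ⟨s, γ, hγ, himp, htot⟩ := hX
  set Δ : ℕ → ℝ := fun t => cutWeight G X (γ (t + 1)) - cutWeight G X (γ t) with hΔ
  have hΔpos : ∀ t < N, 0 < Δ t := fun t ht => sub_pos.2 (himp t ht)
  have hΔeq : ∀ t < N, Δ t = ∑ e : G.edgeSet, change (γ t) (s t) e.1 * X e := by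
    intro t ht
    rw [hΔ]
    simp only
    rw [hγ t ht, cutWeight_flip_sub]
  have hsum : ∑ t ∈ Finset.range N, Δ t ≤ ε := by
    rw [Finset.sum_range_sub (fun t => cutWeight G X (γ t))]
    exact htot
  have hpair : ∀ i j, IsArc N s i j → 0 < Δ i + Δ j ∧ Δ i + Δ j ≤ ε ∧
      Δ i + Δ j = ∑ e : G.edgeSet, (change (γ i) (s i) e.1 + change (γ j) (s j) e.1) * X e := by
    intro i j h
    have hj := h.2.1
    have hi := h.1.trans hj
    refine ⟨add_pos (hΔpos i hi) (hΔpos j hj), ?_, ?_⟩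
    · rw [← Finset.sum_pair h.1.ne]
      refine (Finset.sum_le_sum_of_subset_of_nonneg ?_ ?_).trans hsum
      · intro t ht
        simp only [Finset.mem_insert, Finset.mem_singleton] at ht
        rcases ht with rfl | rfl <;> simpa
      · exact fun t ht _ => (hΔpos t (Finset.mem_range.1 ht)).le
    · rw [hΔeq i hi, hΔeq j hj, ← Finset.sum_add_distrib]
      exact Finset.sum_congr rfl fun e _ => (add_mul _ _ _).symm
  have hval : ∀ i j, IsArc N s i j → ∃ u, G.Adj (s i) u ∧ γ i u ≠ γ j u := by
    intro i j h
    by_contra! hc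
    obtain ⟨h1, -, h3⟩ := hpair i j h
    have hz : ∑ e : G.edgeSet, (change (γ i) (s i) e.1 + change (γ j) (s j) e.1) * X e = 0 := by
      refine Finset.sum_eq_zero fun e _ => ?_
      rw [← h.2.2.1, change_add_change_eq_zero (h.eq_neg hγ) hc,
        zero_mul]
    rw [h3, hz] at h1
    exact lt_irrefl _ h1
  obtain ⟨A, C, h1, h2, h3, h4⟩ := (hasCertificate hm hN0 hN hT hγ hval).exists_claims hγ
  refine ⟨A, C, h1, h2, h3, fun c hc => ?_⟩
  obtain ⟨i, j, harc, heq⟩ := h4 c hc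
  obtain ⟨g1, g2, g3⟩ := hpair i j harc
  simp only [heq]
  rw [← g3, abs_of_pos g1]
  exact g2

open scoped Classical in
theorem weightLaw_badWeights_le [Fintype V] {N m : ℕ} {ε φ : ℝ} (hm : 0 < m) (hN0 : 0 < N)
    (hN : N = 2 * Fintype.card V) (hT : N ≤ 2 ^ m ^ 2) {𝒳 : G.edgeSet → Measure ℝ}
    (h𝒳 : ∀ e, IsSmoothedLaw (𝒳 e) φ) (hε : 0 ≤ 2 * ε * φ)
    (hsmall : Fintype.card (Claim V N) *
      ((Fintype.card (Claim V N) + 1) ^ (2640 * m) * (2 * ε * φ)) ≤ 1) :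
    weightLaw G 𝒳 (badWeights G N ε) ≤ ENNReal.ofReal (2 * (Fintype.card (Claim V N) *
      ((Fintype.card (Claim V N) + 1) ^ (2640 * m) * (2 * ε * φ)))) := by
  set P : Finset (Finset (Claim V N) × Finset (Claim V N)) := Finset.univ.filter fun p =>
    p.1.Nonempty ∧ p.2.card ≤ 2640 * m * p.1.card ∧ IsDiagonal G p.1 p.2 with hP
  have hsub : badWeights G N ε ⊆ ⋃ p ∈ P,
      {X | ∀ c ∈ p.1, |∑ e : G.edgeSet, claimedChange p.2 c e.1 * X e| ≤ ε} := by
    intro X hX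
    obtain ⟨A, C, h1, h2, h3, h4⟩ := exists_claims_of_mem_badWeights hm hN0 hN hT hX
    simp only [Set.mem_iUnion]
    exact ⟨(A, C), by
                    simp only [hP, Finset.mem_filter, Finset.mem_univ, true_and]
                    exact ⟨h1, h2, h3⟩, h4⟩
  calc weightLaw G 𝒳 (badWeights G N ε) ≤ _ := measure_mono hsub
    _ ≤ ∑ p ∈ P, weightLaw G 𝒳
          {X | ∀ c ∈ p.1, |∑ e : G.edgeSet, claimedChange p.2 c e.1 * X e| ≤ ε} :=
        measure_biUnion_finset_le _ _
    _ ≤ ∑ p ∈ P, ENNReal.ofReal ((2 * ε * φ) ^ p.1.card) := by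
        refine Finset.sum_le_sum fun p hp => ?_
        rw [ENNReal.ofReal_pow hε]
        exact pi_forall_abs_sum_le 𝒳 h𝒳 p.1 (fun c e => claimedChange p.2 c e.1)
          (Finset.mem_filter.1 hp).2.2.2 ε
    _ = ENNReal.ofReal (∑ p ∈ P, (2 * ε * φ) ^ p.1.card) :=
        (ENNReal.ofReal_sum_of_nonneg fun _ _ => by positivity).symm
    _ ≤ _ := by
        refine ENNReal.ofReal_le_ofReal (sum_pow_card_le hε hsmall P fun p hp => ?_)
        have := (Finset.mem_filter.1 hp).2
        exact ⟨this.1, this.2.1⟩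

end UnionBound

/-! ### From blocks to path lengths, and the choice of constants -/

section Final

variable {V : Type u} [Fintype V] {G : SimpleGraph V}

open scoped Classical in
theorem abs_cutWeight_le {X : G.edgeSet → ℝ} (hX : ∀ e, |X e| ≤ 1) (γ : Config V) :
    |cutWeight G X γ| ≤ (Fintype.card V : ℝ) ^ 2 := by
  have hcard : Fintype.card G.edgeSet ≤ Fintype.card V ^ 2 := by
    calc Fintype.card G.edgeSet ≤ Fintype.card (Sym2 V) := Fintype.card_subtype_le _
      _ ≤ Fintype.card (V × V) :=
        Fintype.card_le_of_surjective (fun p : V × V => s(p.1, p.2)) fun e => by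
          induction e with
          | h a b => exact ⟨(a, b), rfl⟩
      _ = _ := by rw [Fintype.card_prod, sq]
  calc |cutWeight G X γ| ≤ ∑ e : G.edgeSet, (1 : ℝ) := by
        refine (Finset.abs_sum_le_sum_abs _ _).trans (Finset.sum_le_sum fun e _ => ?_)
        split_ifs
        · exact hX e
        · simp
    _ = Fintype.card G.edgeSet := by simp
    _ ≤ _ := by exact_mod_cast hcard

/-- An improving path consisting of many blocks of length `N` has a large total improvement. -/
theorem mul_div_le_of_path {N : ℕ} {ε : ℝ} {X : G.edgeSet → ℝ} (hX : ∀ e, |X e| ≤ 1)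
    (hbad : X ∉ badWeights G N ε) {f : ℕ → Config V} {l : ℕ}
    (hf : ∀ t < l, (configGraph G X).Adj (f t) (f (t + 1))) (hN : 0 < N) :
    ((l / N : ℕ) : ℝ) * ε ≤ 2 * (Fintype.card V : ℝ) ^ 2 := by
  rcases Nat.eq_zero_or_pos l with rfl | hl
  · simp
  obtain ⟨v₀, -⟩ := hf 0 hl
  have : Nonempty V := ⟨v₀⟩
  choose! s hs himp using hf
  have hblock : ∀ b : ℕ, b * N ≤ l → (b : ℝ) * ε ≤
      cutWeight G X (f (b * N)) - cutWeight G X (f 0) := by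
    intro b
    induction b with
    | zero => simp
    | succ b ih =>
      intro hb
      rw [add_mul, one_mul] at hb ⊢
      have h1 := ih (by omega)
      have h2 : ε < cutWeight G X (f (b * N + N)) - cutWeight G X (f (b * N)) := by
        by_contra hc
        refine hbad ⟨fun t => s (b * N + t), fun t => f (b * N + t), fun t ht => ?_,
          fun t ht => ?_, by simpa using hc⟩
        · exact hs (b * N + t) (by omega)
        · exact himp (b * N + t) (by omega)
      push_cast
      linarith
  have h1 := hblock (l / N) (Nat.div_mul_le_self l N)
  have h2 := abs_le.1 (abs_cutWeight_le hX (f (l / N * N)))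
  have h3 := abs_le.1 (abs_cutWeight_le hX (f 0))
  linarith [h2.2, h3.1]

/-- A run that has not halted within `T` flips traces an improving path of length `⌊T⌋₊ + 1 > T`. -/
theorem terminatesWithin_of_path_bound {X : G.edgeSet → ℝ} {T : ℝ}
    (h : ∀ (f : ℕ → Config V) (l : ℕ), (∀ t < l, (configGraph G X).Adj (f t) (f (t + 1))) →
      (l : ℝ) ≤ T) (R : PivotRule G X) (γ₀ : Config V) : R.TerminatesWithin γ₀ T := by
  have hT : 0 ≤ T := by simpa using h (fun _ => γ₀) 0 (by simp)
  by_contra hc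
  simp only [PivotRule.TerminatesWithin, not_exists, not_and] at hc
  have hstep : ∀ t < ⌊T⌋₊ + 1,
      (configGraph G X).Adj (R.run γ₀ t).2 (R.run γ₀ (t + 1)).2 := by
    intro t ht
    have hle : (t : ℝ) ≤ T := (Nat.cast_le.2 (Nat.lt_succ_iff.1 ht)).trans (Nat.floor_le hT)
    have hno := hc t hle
    refine ⟨R.select (R.run γ₀ t).1 (R.run γ₀ t).2 hno, ?_⟩
    have heq : (R.run γ₀ (t + 1)).2 =
        flip (R.run γ₀ t).2 (R.select (R.run γ₀ t).1 (R.run γ₀ t).2 hno) := by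
      rw [PivotRule.run, dif_neg hno]
    rw [heq]
    exact ⟨rfl, R.improving _ _ _⟩
  have h1 := h (fun t => (R.run γ₀ t).2) (⌊T⌋₊ + 1) hstep
  push_cast at h1
  have h2 := Nat.lt_floor_add_one T
  linarith

theorem length_le_of_path_bound {X : G.edgeSet → ℝ} {T : ℝ}
    (h : ∀ (f : ℕ → Config V) (l : ℕ), (∀ t < l, (configGraph G X).Adj (f t) (f (t + 1))) →
      (l : ℝ) ≤ T) {r : SetRel (Config V) (Config V)}
    (hr : ∀ γ γ', (γ, γ') ∈ r → (configGraph G X).Adj γ γ') (p : RelSeries r) :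
    (p.length : ℝ) ≤ T := by
  refine h (fun t => p.toFun (Fin.ofNat (p.length + 1) t)) p.length fun t ht => ?_
  have h1 := p.step ⟨t, ht⟩
  have e1 : Fin.ofNat (p.length + 1) t = (⟨t, ht⟩ : Fin p.length).castSucc := by
    ext
    simp [Nat.mod_eq_of_lt (show t < p.length + 1 by omega)]
  have e2 : Fin.ofNat (p.length + 1) (t + 1) = (⟨t, ht⟩ : Fin p.length).succ := by
    ext
    simp [Nat.mod_eq_of_lt (show t + 1 < p.length + 1 by omega)]
  rw [e1, e2]
  exact hr _ _ h1

open scoped Classical in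
theorem weightLaw_exists_one_lt_abs {φ : ℝ} {𝒳 : G.edgeSet → Measure ℝ}
    (h𝒳 : ∀ e, IsSmoothedLaw (𝒳 e) φ) : weightLaw G 𝒳 {X | ∃ e, 1 < |X e|} = 0 := by
  have : ∀ e, IsProbabilityMeasure (𝒳 e) := fun e => (h𝒳 e).isProbabilityMeasure
  have hsub : {X : G.edgeSet → ℝ | ∃ e, 1 < |X e|} ⊆
      ⋃ e, (Function.eval e) ⁻¹' (Set.Icc (-1) 1)ᶜ := by
    rintro X ⟨e, he⟩
    refine Set.mem_iUnion.2 ⟨e, fun h => ?_⟩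
    exact absurd (abs_le.2 h) (not_le.2 he)
  refine measure_mono_null hsub (measure_iUnion_null fun e => ?_)
  exact (measurePreserving_eval 𝒳 e).quasiMeasurePreserving.preimage_null (h𝒳 e).supported

/-- For `m = ⌈2 √(log n)⌉` one has `m ^ 2 * log 2 ≥ 2 * log n ≥ log (2 * n)`. The lower bound on
`√(log n)` serves to absorb additive constants. -/
theorem scale_conditions {n : ℕ} (hn : 2 ≤ n) :
    ∃ m : ℕ, 0 < m ∧ 2 * n ≤ 2 ^ m ^ 2 ∧ (m : ℝ) ≤ 4 * √(Real.log n) ∧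
      1 / 2 ≤ √(Real.log n) := by
  have hn' : (2 : ℝ) ≤ n := by exact_mod_cast hn
  have hlog2 := Real.log_two_gt_d9
  have hlog : Real.log 2 ≤ Real.log n := Real.log_le_log (by norm_num) hn'
  have hsq : √(Real.log n) ^ 2 = Real.log n := Real.sq_sqrt (by linarith)
  have hhalf : 1 / 2 ≤ √(Real.log n) := by
    refine Real.le_sqrt_of_sq_le ?_
    norm_num
    linarith
  refine ⟨⌈2 * √(Real.log n)⌉₊, Nat.ceil_pos.2 (by linarith), ?_, ?_, hhalf⟩
  · set m := ⌈2 * √(Real.log n)⌉₊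
    have hm : 2 * √(Real.log n) ≤ m := Nat.le_ceil _
    have hm2 : 4 * Real.log n ≤ (m : ℝ) ^ 2 := by
      rw [← hsq]
      nlinarith
    have h1 : (2 * n : ℝ) ≤ 2 ^ (m ^ 2) := by
      calc (2 * n : ℝ) ≤ n * n := by nlinarith
        _ = Real.exp (Real.log n + Real.log n) := by
          rw [Real.exp_add, Real.exp_log (by linarith)]
        _ ≤ Real.exp (((m ^ 2 : ℕ) : ℝ) * Real.log 2) := by
          refine Real.exp_le_exp.2 ?_
          push_cast
          nlinarith
        _ = _ := by rw [Real.exp_nat_mul, Real.exp_log (by norm_num)]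
    exact_mod_cast h1
  · have := Nat.ceil_lt_add_one (show 0 ≤ 2 * √(Real.log n) by positivity)
    linarith

theorem card_claim_add_one_le {n : ℕ} (hn : 2 ≤ n) (hV : Fintype.card V = n) :
    Fintype.card (Claim V (2 * n)) + 1 ≤ n ^ 8 := by
  simp only [Claim, Fintype.card_prod, Fintype.card_fin, hV, Fintype.card_units_int]
  have h1 : 2 ^ 5 ≤ n ^ 5 := Nat.pow_le_pow_left hn 5
  calc n * ((2 * n + 1) * ((2 * n + 1) * 2)) + 1 ≤ 2 ^ 5 * n ^ 3 := by
        nlinarith [Nat.mul_le_mul hn hn]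
    _ ≤ n ^ 5 * n ^ 3 := Nat.mul_le_mul_right _ h1
    _ = n ^ 8 := by ring

theorem path_length_le {n m l : ℕ} {φ ε : ℝ} {M : ℕ} (hn : 2 ≤ n) (hφ : 1 / 2 ≤ φ)
    (hM : M + 1 ≤ n ^ 8) (hε : ε = 1 / (2 * φ * n * (M + 1) ^ (2640 * m + 1)))
    (hl : ((l / (2 * n) : ℕ) : ℝ) * ε ≤ 2 * (n : ℝ) ^ 2)
    (hm : (m : ℝ) ≤ 4 * √(Real.log n)) (hhalf : 1 / 2 ≤ √(Real.log n)) :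
    (l : ℝ) ≤ φ * (n : ℝ) ^ (100000 * √(Real.log n)) := by
  have hn' : (2 : ℝ) ≤ n := by exact_mod_cast hn
  have hn0 : (0 : ℝ) < n := by linarith
  have hM' : ((M : ℝ) + 1) ≤ (n : ℝ) ^ 8 := by exact_mod_cast hM
  have hφ0 : 0 < φ := by linarith
  set B : ℝ := ((M : ℝ) + 1) ^ (2640 * m + 1) with hB
  have hB0 : 0 < B := by positivity
  have hB1 : B ≤ (n : ℝ) ^ (8 * (2640 * m + 1)) := by
    rw [pow_mul]
    exact pow_le_pow_left₀ (by positivity) hM' _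
  have h1 : ((l / (2 * n) : ℕ) : ℝ) ≤ 2 * (n : ℝ) ^ 2 * (2 * φ * n * B) := by
    rw [hε, mul_one_div, div_le_iff₀ (by positivity)] at hl
    exact hl
  have h2 : (l : ℝ) ≤ 2 * n * (((l / (2 * n) : ℕ) : ℝ) + 1) := by
    have := (Nat.lt_mul_div_succ l (show 0 < 2 * n by omega)).le
    exact_mod_cast this
  have hpow : (1 : ℝ) ≤ (n : ℝ) ^ (8 * (2640 * m + 1)) := one_le_pow₀ (by linarith)
  calc (l : ℝ) ≤ 2 * n * (2 * (n : ℝ) ^ 2 * (2 * φ * n * B) + 1) := by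
        refine h2.trans ?_
        gcongr
    _ = φ * B * (8 * (n : ℝ) ^ 4) + 2 * n := by ring
    _ ≤ φ * (n : ℝ) ^ (8 * (2640 * m + 1)) * (8 * (n : ℝ) ^ 4) +
        (2 * φ * (n : ℝ) ^ (8 * (2640 * m + 1))) * (2 * n) := by
        have : (1 : ℝ) ≤ 2 * φ * (n : ℝ) ^ (8 * (2640 * m + 1)) := by nlinarith
        refine add_le_add ?_ (le_mul_of_one_le_left (by positivity) this)
        gcongr
    _ = φ * (n : ℝ) ^ (8 * (2640 * m + 1)) * (8 * (n : ℝ) ^ 4 + 4 * n) := by ring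
    _ ≤ φ * (n : ℝ) ^ (8 * (2640 * m + 1)) * (n : ℝ) ^ 8 := by
        gcongr
        have h3 : (2 : ℝ) ^ 4 ≤ (n : ℝ) ^ 4 := pow_le_pow_left₀ (by norm_num) hn' 4
        have h4 : (n : ℝ) ≤ (n : ℝ) ^ 4 := le_self_pow₀ (by linarith) (by norm_num)
        calc 8 * (n : ℝ) ^ 4 + 4 * n ≤ 2 ^ 4 * (n : ℝ) ^ 4 := by linarith
          _ ≤ (n : ℝ) ^ 4 * (n : ℝ) ^ 4 := by gcongr
          _ = (n : ℝ) ^ 8 := by ring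
    -- Here `21120 = 8 * 2640` and `16 = 8 + 8`. As `m ≤ 4 √(log n)` and `16 ≤ 32 √(log n)`, the
    -- exponent is below `100000 √(log n)`.
    _ = φ * (n : ℝ) ^ ((21120 * m + 16 : ℕ) : ℝ) := by
        rw [Real.rpow_natCast, mul_assoc, ← pow_add]
        congr 2
        ring
    _ ≤ φ * (n : ℝ) ^ (100000 * √(Real.log n)) := by
        gcongr
        · linarith
        · push_cast
          linarith

/-- With probability at least `1 - 2 / n`, all improving paths are short. -/
theorem le_weightLaw_path_bound {n : ℕ} (hn : 2 ≤ n) (hV : Fintype.card V = n) {φ : ℝ}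
    (hφ : 0 < φ) {𝒳 : G.edgeSet → Measure ℝ} (h𝒳 : ∀ e, IsSmoothedLaw (𝒳 e) φ) :
    1 - 2 / (n : ℝ) ≤ (weightLaw G 𝒳).real {X | ∀ (f : ℕ → Config V) (l : ℕ),
      (∀ t < l, (configGraph G X).Adj (f t) (f (t + 1))) →
        (l : ℝ) ≤ φ * (n : ℝ) ^ (100000 * √(Real.log n))} := by
  classical
  have hprob : ∀ e, IsProbabilityMeasure (𝒳 e) := fun e => (h𝒳 e).isProbabilityMeasure
  have hpm : IsProbabilityMeasure (weightLaw G 𝒳) := by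
    unfold weightLaw
    infer_instance
  have hn0 : (0 : ℝ) < n := by
    have : (2 : ℝ) ≤ n := by exact_mod_cast hn
    linarith
  set S := {X : G.edgeSet → ℝ | ∀ (f : ℕ → Config V) (l : ℕ),
      (∀ t < l, (configGraph G X).Adj (f t) (f (t + 1))) →
        (l : ℝ) ≤ φ * (n : ℝ) ^ (100000 * √(Real.log n))} with hS
  -- Without edges `φ` may be smaller than `1 / 2`, but then no flip is improving.
  rcases isEmpty_or_nonempty G.edgeSet with hE | ⟨⟨e₀⟩⟩
  · have huniv : S = Set.univ := by
      refine Set.eq_univ_of_forall fun X f l hf => ?_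
      rcases Nat.eq_zero_or_pos l with rfl | hl
      · simp only [Nat.cast_zero]
        positivity
      · obtain ⟨v, -, hv⟩ := hf 0 hl
        simp [cutWeight] at hv
    rw [huniv, probReal_univ]
    have : 0 ≤ 2 / (n : ℝ) := by positivity
    linarith
  have hφ2 := (h𝒳 e₀).half_le
  obtain ⟨m, hm, hT, hm4, hhalf⟩ := scale_conditions hn
  have hcard := card_claim_add_one_le hn hV
  set M := Fintype.card (Claim V (2 * n)) with hM
  -- Chosen so that the union bound is at most `2 / n`.
  set ε : ℝ := 1 / (2 * φ * n * (M + 1) ^ (2640 * m + 1)) with hε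
  have hε0 : 0 < ε := by positivity
  have hsmall : M * (((M : ℝ) + 1) ^ (2640 * m) * (2 * ε * φ)) ≤ 1 / n := by
    have e1 : M * (((M : ℝ) + 1) ^ (2640 * m) * (2 * ε * φ)) = M / (M + 1) * (1 / n) := by
      rw [hε, pow_succ]
      field_simp
    rw [e1]
    refine mul_le_of_le_one_left (by positivity) ?_
    rw [div_le_one (by positivity)]
    linarith
  have hbad : weightLaw G 𝒳 (badWeights G (2 * n) ε) ≤ ENNReal.ofReal (2 / n) := by
    refine (weightLaw_badWeights_le (m := m) hm (by omega) (by rw [hV]) hT h𝒳 (by positivity)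
      (hsmall.trans ?_)).trans (ENNReal.ofReal_le_ofReal ?_)
    · rw [div_le_one hn0]
      exact_mod_cast (by omega : 1 ≤ n)
    · calc _ ≤ 2 * (1 / (n : ℝ)) := by gcongr
        _ = 2 / n := by ring
  have hcover : (Set.univ : Set (G.edgeSet → ℝ)) ⊆
      S ∪ (badWeights G (2 * n) ε ∪ {X | ∃ e, 1 < |X e|}) := by
    intro X _
    by_cases h1 : X ∈ badWeights G (2 * n) ε
    · exact Or.inr (Or.inl h1)
    by_cases h2 : ∃ e, 1 < |X e|
    · exact Or.inr (Or.inr h2)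
    push Not at h2
    refine Or.inl fun f l hf => ?_
    have h3 := mul_div_le_of_path h2 h1 hf (by omega)
    rw [hV] at h3
    exact path_length_le hn hφ2 hcard hε h3 hm4 hhalf
  have h1 : (1 : ENNReal) ≤ weightLaw G 𝒳 S + ENNReal.ofReal (2 / n) := by
    calc (1 : ENNReal) = weightLaw G 𝒳 Set.univ := measure_univ.symm
      _ ≤ _ := measure_mono hcover
      _ ≤ _ := measure_union_le _ _
      _ ≤ weightLaw G 𝒳 S + ENNReal.ofReal (2 / n) := by
        gcongr
        refine (measure_union_le _ _).trans ?_
        rw [weightLaw_exists_one_lt_abs h𝒳, add_zero]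
        exact hbad
  have h2 := ENNReal.toReal_mono (by finiteness) h1
  rw [ENNReal.toReal_one, ENNReal.toReal_add (by finiteness) (by finiteness),
    ENNReal.toReal_ofReal (by positivity)] at h2
  rw [measureReal_def]
  linarith

end Final
end LocalMaxCut

theorem theorem1 :
    ∃ C : ℝ, 0 < C ∧ ∃ δ : ℕ → ℝ, Tendsto δ atTop (𝓝 0) ∧
      ∀ (n : ℕ) (V : Type u) [Fintype V], Fintype.card V = n →
      ∀ (G : SimpleGraph V) (φ : ℝ), 0 < φ →
      ∀ 𝒳 : G.edgeSet → Measure ℝ, (∀ e, LocalMaxCut.IsSmoothedLaw (𝒳 e) φ) →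
        (1 : ℝ) - δ n ≤ (LocalMaxCut.weightLaw G 𝒳).real
          {X : G.edgeSet → ℝ |
            (∀ (R : LocalMaxCut.PivotRule G X) (γ₀ : LocalMaxCut.Config V),
              R.TerminatesWithin γ₀ (φ * (n : ℝ) ^ (C * √(Real.log n)))) ∧
            (∀ p : RelSeries {(γ, γ') | (LocalMaxCut.configGraph G X).Adj γ γ'},
              (p.length : ℝ) ≤ φ * (n : ℝ) ^ (C * √(Real.log n)))} := by
  -- For `n < 2` the value `δ n = 1` makes the claim empty.
  refine ⟨100000, by norm_num, fun n => if n < 2 then 1 else 2 / n, ?_, ?_⟩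
  · refine (tendsto_const_div_atTop_nhds_zero_nat (2 : ℝ)).congr' ?_
    filter_upwards [eventually_ge_atTop 2] with n hn
    rw [if_neg (by omega)]
  · intro n V _ hV G φ hφ 𝒳 h𝒳
    by_cases hn : n < 2
    · simp [hn]
    · simp only [if_neg hn]
      have : ∀ e, IsProbabilityMeasure (𝒳 e) := fun e => (h𝒳 e).isProbabilityMeasure
      have : IsProbabilityMeasure (LocalMaxCut.weightLaw G 𝒳) := by
        unfold LocalMaxCut.weightLaw
        infer_instance
      refine (LocalMaxCut.le_weightLaw_path_bound (by omega) hV hφ h𝒳).trans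
        (measureReal_mono fun X hX => ⟨fun R γ₀ => ?_, fun p => ?_⟩)
      · exact LocalMaxCut.terminatesWithin_of_path_bound hX R γ₀
      · exact LocalMaxCut.length_le_of_path_bound hX (fun _ _ h => h) p
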